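/- Let $r$ be a positive integer and let $R=\bigoplus_{\mathbf n\in\mathbb Z^r}R_{\mathbf n}$ be a commutative Noetherian $\mathbb Z^r$-graded ring that is positively graded ($R_{\mathbf n}=0$ unless $\mathbf n\ge \mathbf 0$ componentwise) and standard ($R=R_{\mathbf 0}[R_{\mathbf e_1},\dots,R_{\mathbf e_r}]$, where $\mathbf e_1,\dots,\mathbf e_r$ is the standard basis of $\mathbb Z^r$). A prefix $*$ refers to the category of $\mathbb Z^r$-graded modules and homogeneous homomorphisms of degree $\mathbf 0$; thus ${}^*E(-)$ denotes the injective envelope in that category. The shift $N(\mathbf b)$ of a graded module $N$ is given by $N(\mathbf b)_{\mathbf n}=N_{\mathbf n+\mathbf b}$. Let $M$ be a $\mathbb Z^r$-graded $R$-module, let $0\to {}^*E^0(M)\to {}^*E^1(M)\to\cdots$ be its minimal $*$injective resolution, and for each $i\ge 0$ let $$\theta_i:{}^*E^i(M)\xrightarrow{\ \cong\ }\bigoplus_{\alpha\in\Lambda_i}{}^*E(R/\mathfrak p_\alpha)(-\mathbf n_\alpha)$$ be a $\mathbb Z^r$-homogeneous isomorphism, where the $\mathfrak p_\alpha$ are graded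 prime ideals of $R$ and $\mathbf n_\alpha\in\mathbb Z^r$. Let $\mathfrak p$ be a graded prime ideal of $R$ containing $R_{(1,\dots,1)}$. Put $\operatorname{dir}(\mathfrak p)=\{j: R_{\mathbf e_j}\subseteq\mathfrak p\}=\{i_1<\dots<i_m\}$ and let $\phi:\mathbb Z^r\to\mathbb Z^m$ be given by $\phi(n_1,\dots,n_r)=(n_{i_1},\dots,n_{i_m})$. For a $\mathbb Z^r$-graded ring or module $L$ let $L^{\phi}$ denote $L$ with the $\mathbb Z^m$-grading $(L^{\phi})_{\mathbf a}=\bigoplus_{\phi(\mathbf n)=\mathbf a}L_{\mathbf n}$. Let $R_{(\mathfrak p)}$ and $M_{(\mathfrak p)}$ be the localizations of $R$ and $M$ at the set of homogeneous elements of $R\setminus\mathfrak p$, with their natural $\mathbb Z^r$-gradings, and let $T=R_{(\mathfrak p)}/\mathfrak pR_{(\mathfrak p)}$. For $i\ge 0$ let ${}^*\mathrm{Ext}^i_{R_{(\mathfrak p)}}(T,M_{(\mathfrak p)})$ be the $i$-th cohomology module of the complex ${}^*\mathrm{Hom}_{R_{(\mathfrak p)}}(T,J^\bullet)$, where $J^\bullet$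 is any $*$injective resolution of $M_{(\mathfrak p)}$ over $R_{(\mathfrak p)}$ (such resolutions exist) and ${}^*\mathrm{Hom}$ is the graded module whose component of degree $\mathbf n$ consists of the homogeneous homomorphisms of degree $\mathbf n$; it is a $\mathbb Z^r$-graded $T$-module. Then, for all $i\ge 0$ and all $\mathbf a\in\mathbb Z^m$, the $(T^{\phi})_{\mathbf 0}$-module $\big({}^*\mathrm{Ext}^i_{R_{(\mathfrak p)}}(T,M_{(\mathfrak p)})^{\phi}\big)_{\mathbf a}$ is free, and $$\#\{\alpha\in\Lambda_i:\ \mathfrak p_\alpha=\mathfrak p\ \text{and}\ \phi(\mathbf n_\alpha)=\mathbf a\}=\operatorname{rank}_{(T^{\phi})_{\mathbf 0}}\Big(\big({}^*\mathrm{Ext}^i_{R_{(\mathfrak p)}}(T,M_{(\mathfrak p)})^{\phi}\big)_{\mathbf a}\Big),$$ as an equality of (possibly infinite) cardinals. -/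

import Mathlib

open DirectSum

universe u

noncomputable section

namespace MultiGraded

section GradedModules

variable {G : Type*} [AddCommGroup G]
variable {R : Type*} [CommRing R]
variable {M : Type*} [AddCommGroup M] [Module R M]
variable {N : Type*} [AddCommGroup N] [Module R N]

/-- The family `ℳ` of additive subgroups makes `M` a `G`-graded module over the ring `R` graded by
`𝒜`. -/
structure IsGradedModule [DecidableEq G] (𝒜 : G → AddSubgroup R) (ℳ : G → AddSubgroup M) :
    Prop where
  gradedSMul : SetLike.GradedSMul 𝒜 ℳ
  isInternal : DirectSum.IsInternal ℳ

/-- `f (M_g) ⊆ N_{g+a}` for all `g`: the `R`-homomorphism `f` is homogeneous of degree `a`. -/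
def IsHomogOfDegree (ℳ : G → AddSubgroup M) (𝒩 : G → AddSubgroup N) (a : G) (f : M →ₗ[R] N) :
    Prop :=
  ∀ g, ∀ x ∈ ℳ g, f x ∈ 𝒩 (g + a)

/-- Morphisms of graded modules: homogeneous homomorphisms of degree `0`. -/
def IsHomog (ℳ : G → AddSubgroup M) (𝒩 : G → AddSubgroup N) (f : M →ₗ[R] N) : Prop :=
  IsHomogOfDegree ℳ 𝒩 0 f

/-- A submodule is graded if it is the sum of its intersections with the graded components. -/
def IsGradedSubmodule (ℳ : G → AddSubgroup M) (L : Submodule R M) : Prop :=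
  L.toAddSubgroup = ⨆ g, L.toAddSubgroup ⊓ ℳ g

/-- `M` is a *essential extension of `L`: every non-zero graded submodule of `M` meets `L`
non-trivially. -/
def IsStarEssential (ℳ : G → AddSubgroup M) (L : Submodule R M) : Prop :=
  ∀ K : Submodule R M, IsGradedSubmodule ℳ K → K ≠ ⊥ → K ⊓ L ≠ ⊥

/-- The shift `M(a)`, with `M(a)_g = M_{g+a}`. -/
def shift (ℳ : G → AddSubgroup M) (a : G) : G → AddSubgroup M := fun g => ℳ (g + a)

/-- The grading of a direct sum of graded modules. -/
def directSumGrading {Λ : Type*} {X : Λ → Type*} [∀ α, AddCommGroup (X α)]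
    (𝒳 : ∀ α, G → AddSubgroup (X α)) (g : G) : AddSubgroup (⨁ α, X α) where
  carrier := {x | ∀ α, x α ∈ 𝒳 α g}
  zero_mem' := fun α => (𝒳 α g).zero_mem
  add_mem' := fun hx hy α => (𝒳 α g).add_mem (hx α) (hy α)
  neg_mem' := fun hx α => (𝒳 α g).neg_mem (hx α)

/-- For a homomorphism `φ : G → H`, the `H`-grading `M^φ`, where `(M^φ)_h` is the sum of the
components `M_g` with `φ g = h`. -/
def regrade {H : Type*} [AddCommGroup H] (φ : G →+ H) (ℳ : G → AddSubgroup M) (h : H) :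
    AddSubgroup M :=
  ⨆ g : {g : G // φ g = h}, ℳ g

/-- The grading of `R ⧸ I` by the images of the components of `R`. -/
def quotGrading (𝒜 : G → AddSubgroup R) (I : Ideal R) (g : G) : AddSubgroup (R ⧸ I) :=
  (𝒜 g).map (Ideal.Quotient.mk I).toAddMonoidHom

instance quotGrading.gradedMonoid (𝒜 : G → AddSubgroup R) [SetLike.GradedMonoid 𝒜]
    (I : Ideal R) : SetLike.GradedMonoid (quotGrading 𝒜 I) where
  one_mem := ⟨1, SetLike.GradedOne.one_mem, map_one (Ideal.Quotient.mk I)⟩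
  mul_mem := by
    rintro i j _ _ ⟨x, hx, rfl⟩ ⟨y, hy, rfl⟩
    exact ⟨x * y, SetLike.GradedMul.mul_mem hx hy, map_mul (Ideal.Quotient.mk I) x y⟩

theorem regrade_smul_mem {H : Type*} [AddCommGroup H] (φ : G →+ H)
    {𝒜 : G → AddSubgroup R} {ℳ : G → AddSubgroup M}
    (hs : ∀ i j, ∀ a ∈ 𝒜 i, ∀ x ∈ ℳ j, a • x ∈ ℳ (i + j))
    {h k : H} {a : R} {x : M} (ha : a ∈ regrade φ 𝒜 h) (hx : x ∈ regrade φ ℳ k) :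
    a • x ∈ regrade φ ℳ (h + k) := by
  refine AddSubgroup.iSup_induction (C := fun a => a • x ∈ regrade φ ℳ (h + k)) _ ha ?_ ?_ ?_
  · rintro ⟨i, hi⟩ a ha
    refine AddSubgroup.iSup_induction (C := fun x => a • x ∈ regrade φ ℳ (h + k)) _ hx ?_ ?_ ?_
    · rintro ⟨j, hj⟩ x hx
      exact AddSubgroup.mem_iSup_of_mem
        (S := fun g : {g : G // φ g = h + k} => ℳ g)
        ⟨i + j, by rw [map_add, hi, hj]⟩ (hs i j a ha x hx)
    · rw [smul_zero]; exact AddSubgroup.zero_mem _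
    · intro x y hx hy
      rw [smul_add]; exact AddSubgroup.add_mem _ hx hy
  · rw [zero_smul]; exact AddSubgroup.zero_mem _
  · intro a b ha hb
    rw [add_smul]; exact AddSubgroup.add_mem _ ha hb

instance regrade.gradedMonoid {H : Type*} [AddCommGroup H] (φ : G →+ H)
    (𝒜 : G → AddSubgroup R) [SetLike.GradedMonoid 𝒜] :
    SetLike.GradedMonoid (regrade (M := R) φ 𝒜) where
  one_mem := AddSubgroup.mem_iSup_of_mem
    (S := fun g : {g : G // φ g = 0} => 𝒜 g) ⟨0, map_zero φ⟩ SetLike.GradedOne.one_mem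
  mul_mem := fun _ _ _ _ ha hb =>
    regrade_smul_mem φ (fun _ _ _ hx _ hy => SetLike.GradedMul.mul_mem hx hy) ha hb

end GradedModules

section Injective

variable {G : Type*} [AddCommGroup G] [DecidableEq G]
variable {R : Type u} [CommRing R] (𝒜 : G → AddSubgroup R)
variable {M : Type u} [AddCommGroup M] [Module R M] (ℳ : G → AddSubgroup M)
variable {E : Type u} [AddCommGroup E] [Module R E] (ℰ : G → AddSubgroup E)

/-- `E` is *injective, that is, an injective object of the category of graded `R`-modules. -/
def IsStarInjective : Prop :=
  ∀ (X Y : Type u) [AddCommGroup X] [Module R X] [AddCommGroup Y] [Module R Y]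
    (𝒳 : G → AddSubgroup X) (𝒴 : G → AddSubgroup Y),
    IsGradedModule 𝒜 𝒳 → IsGradedModule 𝒜 𝒴 →
    ∀ (i : X →ₗ[R] Y) (f : X →ₗ[R] E), IsHomog 𝒳 𝒴 i → Function.Injective i → IsHomog 𝒳 ℰ f →
      ∃ h : Y →ₗ[R] E, IsHomog 𝒴 ℰ h ∧ h ∘ₗ i = f

/-- `e : M → E` is a *injective envelope of `M`. -/
structure IsStarInjectiveEnvelope (e : M →ₗ[R] E) : Prop where
  graded : IsGradedModule 𝒜 ℰ
  injective : IsStarInjective 𝒜 ℰ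
  homog : IsHomog ℳ ℰ e
  mono : Function.Injective e
  essential : IsStarEssential ℰ (LinearMap.range e)

/-- A *injective resolution `0 → M → E⁰ → E¹ → ⋯` of the graded module `M`. -/
structure StarInjectiveResolution where
  obj : ℕ → Type u
  [addCommGroup : ∀ i, AddCommGroup (obj i)]
  [module : ∀ i, Module R (obj i)]
  grading : ∀ i, G → AddSubgroup (obj i)
  graded : ∀ i, IsGradedModule 𝒜 (grading i)
  injective : ∀ i, IsStarInjective 𝒜 (grading i)
  ι : M →ₗ[R] obj 0
  d : ∀ i, obj i →ₗ[R] obj (i + 1)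
  homog_ι : IsHomog ℳ (grading 0) ι
  homog_d : ∀ i, IsHomog (grading i) (grading (i + 1)) (d i)
  mono_ι : Function.Injective ι
  exact_zero : Function.Exact ι (d 0)
  exact_succ : ∀ i, Function.Exact (d i) (d (i + 1))

attribute [instance] StarInjectiveResolution.addCommGroup StarInjectiveResolution.module

variable {𝒜 ℳ}

/-- The resolution is minimal: each term is a *injective envelope of the image of the preceding
map. -/
structure StarInjectiveResolution.IsMinimal (I : StarInjectiveResolution 𝒜 ℳ) : Prop where
  essential_zero : IsStarEssential (I.grading 0) (LinearMap.range I.ι)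
  essential_succ : ∀ i, IsStarEssential (I.grading (i + 1)) (LinearMap.range (I.d i))

end Injective

section Ext

variable {G : Type*} [AddCommGroup G]
variable {R : Type u} [CommRing R]
variable {X : Type u} [AddCommGroup X] [Module R X] (𝒳 : G → AddSubgroup X)
variable {Y : Type u} [AddCommGroup Y] [Module R Y] (𝒴 : G → AddSubgroup Y)

/-- `*Hom_R(X, Y)_a`, the group of homogeneous homomorphisms of degree `a`. -/
def starHomDeg (a : G) : AddSubgroup (X →ₗ[R] Y) where
  carrier := {f | IsHomogOfDegree 𝒳 𝒴 a f}
  zero_mem' := fun g _ _ => (𝒴 (g + a)).zero_mem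
  add_mem' := fun hf hg k x hx => (𝒴 (k + a)).add_mem (hf k x hx) (hg k x hx)
  neg_mem' := fun hf k x hx => (𝒴 (k + a)).neg_mem (hf k x hx)

/-- `*Hom_R(X, Y)`, the `R`-submodule of `Hom_R(X, Y)` generated by the homogeneous homomorphisms of
all degrees. (For graded modules `X`, `Y` over a graded ring `R`, the sum of the groups
`*Hom_R(X, Y)_a` is already an `R`-submodule.) -/
def starHom : Submodule R (X →ₗ[R] Y) :=
  Submodule.span R {f | ∃ a, f ∈ starHomDeg 𝒳 𝒴 a}

variable [DecidableEq G] {𝒜 : G → AddSubgroup R}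
variable {N : Type u} [AddCommGroup N] [Module R N] {𝒩 : G → AddSubgroup N}
variable (J : StarInjectiveResolution 𝒜 𝒩)

/-- The `i`-cocycles of the complex `*Hom_R(X, J)`. -/
def starCocycles (i : ℕ) : Submodule R (X →ₗ[R] J.obj i) :=
  starHom 𝒳 (J.grading i) ⊓ LinearMap.ker (LinearMap.compRight R (M := X) (J.d i))

/-- The `i`-coboundaries of the complex `*Hom_R(X, J)`. -/
def starCoboundaries : (i : ℕ) → Submodule R (X →ₗ[R] J.obj i)
  | 0 => ⊥
  | i + 1 => (starHom 𝒳 (J.grading i)).map (LinearMap.compRight R (M := X) (J.d i))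

/-- `*Ext^i_R(X, N)`, the `i`-th cohomology module of `*Hom_R(X, J)`, where `J` is a *injective
resolution of `N`. -/
def StarExt (i : ℕ) : Type u :=
  starCocycles 𝒳 J i ⧸ (starCoboundaries 𝒳 J i).submoduleOf (starCocycles 𝒳 J i)

instance (i : ℕ) : AddCommGroup (StarExt 𝒳 J i) :=
  inferInstanceAs (AddCommGroup
    (starCocycles 𝒳 J i ⧸ (starCoboundaries 𝒳 J i).submoduleOf (starCocycles 𝒳 J i)))

instance (i : ℕ) : Module R (StarExt 𝒳 J i) :=
  inferInstanceAs (Module R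
    (starCocycles 𝒳 J i ⧸ (starCoboundaries 𝒳 J i).submoduleOf (starCocycles 𝒳 J i)))

/-- The cohomology class of a cocycle. -/
def StarExt.mk (i : ℕ) : starCocycles 𝒳 J i →ₗ[R] StarExt 𝒳 J i :=
  ((starCoboundaries 𝒳 J i).submoduleOf (starCocycles 𝒳 J i)).mkQ

/-- The component `*Ext^i_R(X, N)_g`: the classes of cocycles that are homogeneous of degree `g`. -/
def StarExt.grading (i : ℕ) (g : G) : AddSubgroup (StarExt 𝒳 J i) :=
  ((starHomDeg 𝒳 (J.grading i) g).comap (starCocycles 𝒳 J i).subtype.toAddMonoidHom).map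
    (StarExt.mk 𝒳 J i).toAddMonoidHom

variable (I : Ideal R)

theorem StarExt.isTorsionBySet (i : ℕ) :
    Module.IsTorsionBySet R (StarExt (quotGrading 𝒜 I) J i) I := by
  intro x a
  obtain ⟨z, rfl⟩ : ∃ z, StarExt.mk (quotGrading 𝒜 I) J i z = x :=
    Submodule.mkQ_surjective _ x
  have hz : (a : R) • z = 0 := by
    apply Subtype.ext
    ext
    change (a : R) • (z : R ⧸ I →ₗ[R] J.obj i) 1 = 0
    rw [← map_smul]
    have : (a : R) • (1 : R ⧸ I) = 0 := by
      rw [Algebra.smul_def, mul_one]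
      exact Ideal.Quotient.eq_zero_iff_mem.mpr a.2
    rw [this, map_zero]
  rw [← map_smul, hz, map_zero]

/-- `*Ext^i_R(R/I, N)` is an `R/I`-module, being annihilated by `I`. -/
instance StarExt.quotModule (i : ℕ) : Module (R ⧸ I) (StarExt (quotGrading 𝒜 I) J i) :=
  (StarExt.isTorsionBySet J I i).module

theorem StarExt.smul_mem (i : ℕ) (g h : G) (t : R ⧸ I) (ht : t ∈ quotGrading 𝒜 I g)
    (x : StarExt (quotGrading 𝒜 I) J i) (hx : x ∈ StarExt.grading (quotGrading 𝒜 I) J i h) :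
    t • x ∈ StarExt.grading (quotGrading 𝒜 I) J i (g + h) := by
  obtain ⟨s, hs, rfl⟩ := ht
  obtain ⟨z, hz, rfl⟩ := hx
  refine ⟨s • z, ?_, ?_⟩
  · intro k y hy
    have := (J.graded i).gradedSMul.smul_mem hs (hz k y hy)
    rw [vadd_eq_add, show g + (k + h) = k + (g + h) by abel] at this
    exact this
  · exact map_smul (StarExt.mk (quotGrading 𝒜 I) J i) s z

/-- The subring `((R/I)^φ)_0` of `R/I`. -/
abbrev quotRegradedZero (𝒜 : G → AddSubgroup R) [SetLike.GradedMonoid 𝒜] (I : Ideal R)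
    {H : Type*} [AddCommGroup H] (φ : G →+ H) : Subring (R ⧸ I) :=
  SetLike.GradeZero.subring (regrade (M := R ⧸ I) φ (quotGrading 𝒜 I))

/-- The component `(*Ext^i_R(R/I, N)^φ)_a`, as a module over the subring `((R/I)^φ)_0` of `R/I`. -/
def StarExt.regradedComponent [SetLike.GradedMonoid 𝒜] {H : Type*} [AddCommGroup H] (φ : G →+ H)
    (i : ℕ) (a : H) :
    Submodule (quotRegradedZero 𝒜 I φ) (StarExt (quotGrading 𝒜 I) J i) where
  __ := (regrade φ (StarExt.grading (quotGrading 𝒜 I) J i) a).toAddSubmonoid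
  smul_mem' := by
    rintro ⟨t, ht⟩ x hx
    have := regrade_smul_mem (R := R ⧸ I) φ
      (fun g h t ht x hx => StarExt.smul_mem J I i g h t ht x hx) ht hx
    rw [zero_add] at this
    exact this

end Ext

section Localization

variable {G : Type*} [AddCommGroup G]
variable {R : Type*} [CommRing R] (𝒜 : G → AddSubgroup R) [SetLike.GradedMonoid 𝒜]
variable (p : Ideal R) [p.IsPrime]
variable {M : Type*} [AddCommGroup M] [Module R M] (ℳ : G → AddSubgroup M)

/-- The multiplicative set of homogeneous elements of `R` outside `p`. -/
def homogCompl : Submonoid R := SetLike.homogeneousSubmonoid 𝒜 ⊓ p.primeCompl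

/-- The homogeneous localization `R_(p)`. -/
abbrev HomogLoc : Type _ := Localization (homogCompl 𝒜 p)

/-- The homogeneous localization `M_(p)`. -/
abbrev HomogLocModule (M : Type*) [AddCommGroup M] [Module R M] : Type _ :=
  LocalizedModule (homogCompl 𝒜 p) M

/-- The grading of `M_(p)`: the component of degree `n` consists of the fractions `m / s` with `m`
homogeneous of degree `n + deg s`. -/
def locModuleGrading [SetLike.GradedSMul 𝒜 ℳ] (n : G) : AddSubgroup (HomogLocModule 𝒜 p M) where
  carrier := {x | ∃ (h : G) (m : M) (s : homogCompl 𝒜 p),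
    m ∈ ℳ (n + h) ∧ (s : R) ∈ 𝒜 h ∧ x = LocalizedModule.mk m s}
  zero_mem' := ⟨0, 0, 1, AddSubgroup.zero_mem _, SetLike.GradedOne.one_mem,
    (LocalizedModule.zero_mk _).symm⟩
  add_mem' := by
    rintro _ _ ⟨h, m, s, hm, hs, rfl⟩ ⟨h', m', s', hm', hs', rfl⟩
    refine ⟨h + h', s' • m + s • m', s * s', ?_, SetLike.GradedMul.mul_mem hs hs',
      LocalizedModule.mk_add_mk⟩
    have h1 : (s' : R) • m ∈ ℳ (h' +ᵥ (n + h)) := SetLike.GradedSMul.smul_mem hs' hm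
    have h2 : (s : R) • m' ∈ ℳ (h +ᵥ (n + h')) := SetLike.GradedSMul.smul_mem hs hm'
    rw [vadd_eq_add, show h' + (n + h) = n + (h + h') by abel] at h1
    rw [vadd_eq_add, show h + (n + h') = n + (h + h') by abel] at h2
    exact AddSubgroup.add_mem _ h1 h2
  neg_mem' := by
    rintro _ ⟨h, m, s, hm, hs, rfl⟩
    exact ⟨h, -m, s, AddSubgroup.neg_mem _ hm, hs, LocalizedModule.mk_neg.symm⟩

/-- The grading of the ring `R_(p)`: the component of degree `n` consists of the fractions `a / s`
with `a` homogeneous of degree `n + deg s`. -/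
def locGrading (n : G) : AddSubgroup (HomogLoc 𝒜 p) where
  carrier := {x | ∃ (h : G) (a : R) (s : homogCompl 𝒜 p),
    a ∈ 𝒜 (n + h) ∧ (s : R) ∈ 𝒜 h ∧ x = Localization.mk a s}
  zero_mem' := ⟨0, 0, 1, AddSubgroup.zero_mem _, SetLike.GradedOne.one_mem,
    (Localization.mk_zero _).symm⟩
  add_mem' := by
    rintro _ _ ⟨h, a, s, ha, hs, rfl⟩ ⟨h', a', s', ha', hs', rfl⟩
    refine ⟨h + h', s * a' + s' * a, s * s', ?_, SetLike.GradedMul.mul_mem hs hs',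
      Localization.add_mk _ _ _ _⟩
    have h1 : (s' : R) * a ∈ 𝒜 (h' + (n + h)) := SetLike.GradedMul.mul_mem hs' ha
    have h2 : (s : R) * a' ∈ 𝒜 (h + (n + h')) := SetLike.GradedMul.mul_mem hs ha'
    rw [show h' + (n + h) = n + (h + h') by abel] at h1
    rw [show h + (n + h') = n + (h + h') by abel] at h2
    exact AddSubgroup.add_mem _ h2 h1
  neg_mem' := by
    rintro _ ⟨h, a, s, ha, hs, rfl⟩
    exact ⟨h, -a, s, AddSubgroup.neg_mem _ ha, hs, Localization.neg_mk _ _⟩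

instance locGrading.gradedMonoid : SetLike.GradedMonoid (locGrading 𝒜 p) where
  one_mem := ⟨0, 1, 1, by rw [add_zero]; exact SetLike.GradedOne.one_mem,
    SetLike.GradedOne.one_mem, Localization.mk_one.symm⟩
  mul_mem := by
    rintro n n' _ _ ⟨h, a, s, ha, hs, rfl⟩ ⟨h', a', s', ha', hs', rfl⟩
    refine ⟨h + h', a * a', s * s', ?_, SetLike.GradedMul.mul_mem hs hs',
      Localization.mk_mul _ _ _ _⟩
    rw [show n + n' + (h + h') = (n + h) + (n' + h') by abel]
    exact SetLike.GradedMul.mul_mem ha ha'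

/-- The ideal `p R_(p)`. -/
abbrev locIdeal : Ideal (HomogLoc 𝒜 p) := p.map (algebraMap R (HomogLoc 𝒜 p))

end Localization

section Standard

variable {r : ℕ} {R : Type*} [CommRing R] (𝒜 : (Fin r → ℤ) → AddSubgroup R)

/-- `R_n = 0` unless `n ≥ 0` componentwise. -/
def IsPositivelyGraded : Prop := ∀ n : Fin r → ℤ, ¬ 0 ≤ n → 𝒜 n = ⊥

/-- `R = R_0[R_{e_1}, …, R_{e_r}]`. -/
def IsStandard : Prop :=
  Subring.closure ((𝒜 0 : Set R) ∪ ⋃ j : Fin r, (𝒜 (Pi.single j 1) : Set R)) = ⊤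

open Classical in
/-- `dir(p)`, the set of the `j` with `R_{e_j} ⊆ p`. -/
def dir (p : Ideal R) : Finset (Fin r) :=
  Finset.univ.filter fun j => (𝒜 (Pi.single j 1) : Set R) ⊆ p

/-- `φ(p) : ℤ^r → ℤ^m`, `(n_1, …, n_r) ↦ (n_{i_1}, …, n_{i_m})`, where
`dir(p) = {i_1 < ⋯ < i_m}`. -/
def dirHom (p : Ideal R) : (Fin r → ℤ) →+ (Fin (dir 𝒜 p).card → ℤ) where
  toFun n k := n ((dir 𝒜 p).orderEmbOfFin rfl k)
  map_zero' := rfl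
  map_add' _ _ := rfl

end Standard

end MultiGraded

end

/-! Write P = pR_(p) and T = R_(p)/P. Since R is Noetherian, homogeneous localization preserves
*injectives (`IsStarInjective.localized`), so the localization K of the minimal resolution is a
*injective resolution of M_(p). Minimality makes the differentials of K vanish on elements killed by
P (`IsMinimal.localized_d_eq_zero`). Any other resolution J is homotopy equivalent to K, and
homomorphisms out of T are elements killed by P, so *Ext^i(T, M_(p)) is (0 :_{K^i} P), degrees
included (`exists_starExt_equiv`).

This submodule is computed from the decomposition of the i-th term. A summand *E(R/q) with q ≠ p
contributes nothing: a homogeneous element killed by p is also killed by some homogeneous element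
outside p. A summand *E(R/p)(-n) contributes a copy of T generated in degree n
(`exists_smul_eq_of_annihilated`). Thus *Ext^i is the direct sum of the T(-n_α) with p_α = p, with
the classes of the elements `generator` as basis.

Finally, T lies in φ-degree 0: modulo p, a standard ring is generated by R_0 and the R_{e_j} with j
outside dir(p) (`dirHom_eq_zero`). Hence the generators with φ(n_α) = a form a basis of the
component of degree a over (T^φ)_0, and T ≠ 0 gives a well-defined rank
(`free_and_mk_eq_rank_regradedComponent`). -/

noncomputable section

namespace MultiGraded

/-! ### Homogeneous components and internal gradings. -/

section Projections

variable {G : Type*} [DecidableEq G]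
variable {M : Type*} [AddCommGroup M] {ℳ : G → AddSubgroup M}
variable {N : Type*} [AddCommGroup N] {𝒩 : G → AddSubgroup N}

/-- The projection of `M` onto its component of degree `g`. -/
def proj (h : IsInternal ℳ) (g : G) : M →+ M :=
  ((ℳ g).subtype.comp (DFinsupp.evalAddMonoidHom g)).comp
    (AddEquiv.ofBijective (DirectSum.coeAddMonoidHom ℳ) h).symm.toAddMonoidHom

theorem proj_coe (h : IsInternal ℳ) (g : G) (x : ⨁ g, ℳ g) :
    proj h g (DirectSum.coeAddMonoidHom ℳ x) = x g := by
  have : (AddEquiv.ofBijective (DirectSum.coeAddMonoidHom ℳ) h).symm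
      (DirectSum.coeAddMonoidHom ℳ x) = x :=
    (AddEquiv.ofBijective (DirectSum.coeAddMonoidHom ℳ) h).symm_apply_apply x
  change (((AddEquiv.ofBijective (DirectSum.coeAddMonoidHom ℳ) h).symm
      (DirectSum.coeAddMonoidHom ℳ x)) g : M) = x g
  rw [this]

theorem proj_mem (h : IsInternal ℳ) (g : G) (x : M) : proj h g x ∈ ℳ g := by
  obtain ⟨x, rfl⟩ := h.2 x
  rw [proj_coe]
  exact (x g).2

theorem proj_of_mem (h : IsInternal ℳ) {g : G} {x : M} (hx : x ∈ ℳ g) : proj h g x = x := by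
  have := proj_coe h g (DirectSum.of (fun g => ℳ g) g ⟨x, hx⟩)
  rwa [DirectSum.coeAddMonoidHom_of, DirectSum.of_eq_same] at this

theorem proj_of_ne (h : IsInternal ℳ) {g k : G} (hgk : g ≠ k) {x : M} (hx : x ∈ ℳ k) :
    proj h g x = 0 := by
  have := proj_coe h g (DirectSum.of (fun g => ℳ g) k ⟨x, hx⟩)
  rwa [DirectSum.coeAddMonoidHom_of, DirectSum.of_eq_of_ne _ _ _ hgk] at this

theorem exists_eq_sum_proj (h : IsInternal ℳ) (x : M) :
    ∃ s : Finset G, x = ∑ g ∈ s, proj h g x := by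
  classical
  obtain ⟨x, rfl⟩ := h.2 x
  refine ⟨DFinsupp.support x, ?_⟩
  simp only [proj_coe]
  exact DirectSum.coeAddMonoidHom_eq_dfinsuppSum ℳ x

theorem homogeneous_induction (h : IsInternal ℳ) {P : M → Prop} (zero : P 0)
    (add : ∀ x y, P x → P y → P (x + y)) (mem : ∀ g, ∀ x ∈ ℳ g, P x) (x : M) : P x := by
  obtain ⟨s, hs⟩ := exists_eq_sum_proj h x
  rw [hs]
  exact Finset.sum_induction _ P add zero fun g _ => mem g _ (proj_mem h g x)

theorem eq_zero_of_proj (h : IsInternal ℳ) {x : M} (hx : ∀ g, proj h g x = 0) : x = 0 := by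
  obtain ⟨s, hs⟩ := exists_eq_sum_proj h x
  rw [hs]
  exact Finset.sum_eq_zero fun g _ => hx g

/-- A family of additive subgroups that spans and admits a family of projections is internal. -/
theorem isInternal_of_proj (π : G → M →+ M) (same : ∀ g, ∀ x ∈ ℳ g, π g x = x)
    (ne : ∀ g k, g ≠ k → ∀ x ∈ ℳ k, π g x = 0) (top : ⨆ g, ℳ g = ⊤) : IsInternal ℳ := by
  have key : ∀ (x : ⨁ g, ℳ g) (g : G), π g (DirectSum.coeAddMonoidHom ℳ x) = x g := by
    intro x g
    induction x using DirectSum.induction_on with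
    | zero => simp
    | of k x =>
      rw [DirectSum.coeAddMonoidHom_of]
      by_cases hgk : g = k
      · subst hgk
        rw [DirectSum.of_eq_same, same _ _ x.2]
      · rw [DirectSum.of_eq_of_ne _ _ _ hgk, ne _ _ hgk _ x.2]; rfl
    | add x y hx hy => rw [map_add, map_add, hx, hy]; rfl
  constructor
  · rw [injective_iff_map_eq_zero]
    intro x hx
    refine DFinsupp.ext fun g => Subtype.ext ?_
    rw [← key, hx, map_zero]; rfl
  · rw [← AddMonoidHom.range_eq_top, eq_top_iff, ← top, iSup_le_iff]
    exact fun g x hx => ⟨DirectSum.of (fun g => ℳ g) g ⟨x, hx⟩, DirectSum.coeAddMonoidHom_of _ _ _⟩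

/-- A submodule stable under the projections is graded. -/
theorem isGradedSubmodule_of_proj {R : Type*} [CommRing R] [Module R M] (h : IsInternal ℳ)
    {L : Submodule R M}
    (hL : ∀ x ∈ L, ∀ g, proj h g x ∈ L) : IsGradedSubmodule ℳ L := by
  apply le_antisymm
  · intro x hx
    obtain ⟨s, hs⟩ := exists_eq_sum_proj h x
    rw [hs]
    exact sum_mem fun g _ => AddSubgroup.mem_iSup_of_mem g ⟨hL x hx g, proj_mem h g x⟩
  · exact iSup_le fun g => inf_le_left

theorem iSup_eq_top_of_isInternal (h : IsInternal ℳ) : ⨆ g, ℳ g = ⊤ := by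
  rw [eq_top_iff]
  intro x _
  refine homogeneous_induction h (P := fun x => x ∈ ⨆ g, ℳ g) (zero_mem _)
    (fun _ _ => add_mem) (fun g x hx => AddSubgroup.mem_iSup_of_mem g hx) x

theorem proj_map [Add G] [IsRightCancelAdd G] (h : IsInternal ℳ) (h' : IsInternal 𝒩) {a : G}
    (f : M →+ N) (hf : ∀ g, ∀ x ∈ ℳ g, f x ∈ 𝒩 (g + a)) (g : G) (x : M) :
    proj h' (g + a) (f x) = f (proj h g x) := by
  refine homogeneous_induction h (P := fun x => proj h' (g + a) (f x) = f (proj h g x)) (by simp)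
    (fun x y hx hy => by simp [hx, hy]) (fun k x hx => ?_) x
  by_cases hgk : g = k
  · subst hgk
    rw [proj_of_mem h hx, proj_of_mem h' (hf _ _ hx)]
  · rw [proj_of_ne h hgk hx, map_zero, proj_of_ne h' _ (hf _ _ hx)]
    exact fun hh => hgk (add_right_cancel hh)

end Projections

/-! ### Graded modules, homogeneous maps, shifts and graded submodules. -/

section GradedModules

variable {G : Type*} [AddCommGroup G]
variable {R : Type*} [CommRing R] {𝒜 : G → AddSubgroup R}
variable {M : Type*} [AddCommGroup M] [Module R M] {ℳ : G → AddSubgroup M}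
variable {N : Type*} [AddCommGroup N] [Module R N] {𝒩 : G → AddSubgroup N}

theorem IsHomog.mem {f : M →ₗ[R] N} (hf : IsHomog ℳ 𝒩 f) {g : G} {x : M} (hx : x ∈ ℳ g) :
    f x ∈ 𝒩 g := by
  have := hf g x hx
  rwa [add_zero] at this

theorem IsHomog.of_mem {f : M →ₗ[R] N} (hf : ∀ g, ∀ x ∈ ℳ g, f x ∈ 𝒩 g) : IsHomog ℳ 𝒩 f :=
  fun g x hx => by rw [add_zero]; exact hf g x hx

theorem IsHomog.comp {L : Type*} [AddCommGroup L] [Module R L] {ℒ : G → AddSubgroup L}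
    {f : M →ₗ[R] N} {k : N →ₗ[R] L} (hk : IsHomog 𝒩 ℒ k) (hf : IsHomog ℳ 𝒩 f) :
    IsHomog ℳ ℒ (k ∘ₗ f) :=
  IsHomog.of_mem fun _ _ hx => hk.mem (hf.mem hx)

theorem IsHomog.sub {f k : M →ₗ[R] N} (hf : IsHomog ℳ 𝒩 f) (hk : IsHomog ℳ 𝒩 k) :
    IsHomog ℳ 𝒩 (f - k) :=
  fun g x hx => sub_mem (hf g x hx) (hk g x hx)

theorem IsHomog.id : IsHomog ℳ ℳ (LinearMap.id : M →ₗ[R] M) :=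
  IsHomog.of_mem fun _ _ hx => hx

variable [DecidableEq G]

theorem IsGradedModule.smul_mem (h : IsGradedModule 𝒜 ℳ) {g k : G} {a : R} {x : M}
    (ha : a ∈ 𝒜 g) (hx : x ∈ ℳ k) : a • x ∈ ℳ (k + g) := by
  have := h.gradedSMul.smul_mem ha hx
  rwa [vadd_eq_add, add_comm] at this

theorem IsGradedModule.of_smul_mem
    (h : ∀ (g k : G) (a : R) (x : M), a ∈ 𝒜 g → x ∈ ℳ k → a • x ∈ ℳ (k + g))
    (hint : IsInternal ℳ) : IsGradedModule 𝒜 ℳ where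
  gradedSMul := ⟨fun {g k a x} ha hx => by
    rw [vadd_eq_add, add_comm]; exact h g k a x ha hx⟩
  isInternal := hint

theorem IsGradedModule.proj_smul (h : IsGradedModule 𝒜 ℳ) {k : G} {a : R} (ha : a ∈ 𝒜 k)
    (g : G) (x : M) :
    proj h.isInternal (g + k) (a • x) = a • proj h.isInternal g x :=
  proj_map h.isInternal h.isInternal (DistribSMul.toAddMonoidHom M a)
    (fun _ _ hx => h.smul_mem ha hx) g x

theorem IsHomog.proj_map {f : M →ₗ[R] N} (hf : IsHomog ℳ 𝒩 f) (h : IsInternal ℳ)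
    (h' : IsInternal 𝒩) (g : G) (x : M) : proj h' g (f x) = f (proj h g x) := by
  have := MultiGraded.proj_map h h' f.toAddMonoidHom hf g x
  rwa [add_zero] at this

theorem IsGradedModule.shift (h : IsGradedModule 𝒜 ℳ) (a : G) :
    IsGradedModule 𝒜 (shift ℳ a) := by
  refine .of_smul_mem (fun g k r x hr hx => ?_) (isInternal_of_proj
    (fun g => proj h.isInternal (g + a)) (fun g x hx => proj_of_mem h.isInternal hx)
    (fun g k hgk x hx => proj_of_ne h.isInternal (fun hh => hgk (add_right_cancel hh)) hx) ?_)
  · have := h.smul_mem hr hx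
    rwa [add_right_comm] at this
  · rw [← iSup_eq_top_of_isInternal h.isInternal]
    exact (Equiv.addRight a).iSup_comp (g := ℳ)

/-- The grading induced on a submodule. -/
def subGrading (ℳ : G → AddSubgroup M) (L : Submodule R M) (g : G) : AddSubgroup L :=
  (ℳ g).comap L.subtype.toAddMonoidHom

theorem IsGradedModule.submodule (h : IsGradedModule 𝒜 ℳ) {L : Submodule R M}
    (hL : ∀ x ∈ L, ∀ g, proj h.isInternal g x ∈ L) : IsGradedModule 𝒜 (subGrading ℳ L) := by
  let π (g : G) : L →+ L :=
    ((proj h.isInternal g).comp L.subtype.toAddMonoidHom).codRestrict L.toAddSubgroup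
      fun x => hL x x.2 g
  refine .of_smul_mem (fun g k r x hr hx => h.smul_mem hr hx) (isInternal_of_proj π
    (fun g x hx => Subtype.ext (proj_of_mem h.isInternal hx))
    (fun g k hgk x hx => Subtype.ext (proj_of_ne h.isInternal hgk hx)) ?_)
  rw [eq_top_iff]
  intro x _
  obtain ⟨s, hs⟩ := exists_eq_sum_proj h.isInternal (x : M)
  have : x = ∑ g ∈ s, π g x :=
    Subtype.ext (by rw [AddSubmonoidClass.coe_finsetSum]; exact hs)
  rw [this]
  exact sum_mem fun g _ => AddSubgroup.mem_iSup_of_mem g (proj_mem h.isInternal g x.1)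

/-- The homogeneous component of degree `a` of a homomorphism of graded modules. -/
theorem exists_homogeneous_component (h𝒜 : ⨆ g, 𝒜 g = ⊤) (hM : IsGradedModule 𝒜 ℳ)
    (hN : IsGradedModule 𝒜 𝒩) (f : M →ₗ[R] N) (a : G) :
    ∃ f' : M →ₗ[R] N, IsHomogOfDegree ℳ 𝒩 a f' ∧
      ∀ g, ∀ x ∈ ℳ g, f' x = proj hN.isInternal (g + a) (f x) := by
  let F₀ : (⨁ g, ℳ g) →+ N := DirectSum.toAddMonoid fun g =>
    ((proj hN.isInternal (g + a)).comp f.toAddMonoidHom).comp (ℳ g).subtype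
  let F : M →+ N := F₀.comp
    (AddEquiv.ofBijective (DirectSum.coeAddMonoidHom ℳ) hM.isInternal).symm.toAddMonoidHom
  have hF : ∀ g, ∀ x ∈ ℳ g, F x = proj hN.isInternal (g + a) (f x) := by
    intro g x hx
    have : (AddEquiv.ofBijective (DirectSum.coeAddMonoidHom ℳ) hM.isInternal).symm x =
        DirectSum.of (fun g => ℳ g) g ⟨x, hx⟩ := by
      rw [AddEquiv.symm_apply_eq]
      exact (DirectSum.coeAddMonoidHom_of ℳ g ⟨x, hx⟩).symm
    change F₀ ((AddEquiv.ofBijective (DirectSum.coeAddMonoidHom ℳ) hM.isInternal).symm x) = _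
    rw [this, DirectSum.toAddMonoid_of]
    rfl
  have hsmul : ∀ (r : R) (x : M), F (r • x) = r • F x := by
    intro r x
    have hr : r ∈ ⨆ g, 𝒜 g := h𝒜 ▸ AddSubgroup.mem_top r
    refine AddSubgroup.iSup_induction (C := fun r => F (r • x) = r • F x) _ hr ?_ (by simp) ?_
    · intro k r hr
      refine homogeneous_induction hM.isInternal (P := fun x => F (r • x) = r • F x) (by simp)
        (fun x y hx hy => by simp [hx, hy]) (fun g x hx => ?_) x
      rw [hF _ _ (hM.smul_mem hr hx), hF _ _ hx, map_smul, add_right_comm, hN.proj_smul hr]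
    · intro r s hr hs
      simp [add_smul, hr, hs]
  refine ⟨{ F with map_smul' := hsmul }, fun g x hx => ?_, hF⟩
  change F x ∈ _
  rw [hF g x hx]
  exact proj_mem _ _ _

end GradedModules


/-! ### A graded Baer criterion and extension of maps into *injectives. -/

section Extension

variable {G : Type*} [AddCommGroup G] [DecidableEq G]
variable {R : Type u} [CommRing R] {𝒜 : G → AddSubgroup R}
variable {E : Type u} [AddCommGroup E] [Module R E] {ℰ : G → AddSubgroup E}

/-- The components of a multiple of a homogeneous element are multiples of it. -/
theorem IsGradedModule.exists_proj_smul_eq (h𝒜 : ⨆ g, 𝒜 g = ⊤) {Y : Type*} [AddCommGroup Y]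
    [Module R Y] {𝒴 : G → AddSubgroup Y} (hY : IsGradedModule 𝒜 𝒴) {g : G} {y : Y} (hy : y ∈ 𝒴 g)
    (r : R) (k : G) : ∃ c ∈ 𝒜 (k - g), proj hY.isInternal k (r • y) = c • y := by
  have hr : r ∈ ⨆ g, 𝒜 g := h𝒜 ▸ AddSubgroup.mem_top r
  refine AddSubgroup.iSup_induction
    (C := fun r => ∃ c ∈ 𝒜 (k - g), proj hY.isInternal k (r • y) = c • y) _ hr ?_ ?_ ?_
  · intro l r hr
    by_cases hl : k = g + l
    · subst hl
      exact ⟨r, by rwa [add_sub_cancel_left], proj_of_mem _ (hY.smul_mem hr hy)⟩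
    · exact ⟨0, zero_mem _, by rw [proj_of_ne _ hl (hY.smul_mem hr hy), zero_smul]⟩
  · exact ⟨0, zero_mem _, by simp⟩
  · rintro r s ⟨c, hc, hc'⟩ ⟨d, hd, hd'⟩
    exact ⟨c + d, add_mem hc hd, by rw [add_smul, map_add, hc', hd', add_smul]⟩

/-- A partial homomorphism whose domain is graded and which preserves degrees. -/
structure IsHomogPMap {Y : Type*} [AddCommGroup Y] [Module R Y] {𝒴 : G → AddSubgroup Y}
    (hY : IsGradedModule 𝒜 𝒴) (ℰ : G → AddSubgroup E) (f : Y →ₗ.[R] E) : Prop where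
  proj_mem : ∀ x ∈ f.domain, ∀ g, proj hY.isInternal g x ∈ f.domain
  map_mem : ∀ (g : G) (x : f.domain), (x : Y) ∈ 𝒴 g → f x ∈ ℰ g

/-- Baer's criterion in its one-step form: it is enough to extend partial homomorphisms to one more
homogeneous element. -/
theorem isStarInjective_of_extend (h𝒜 : ⨆ g, 𝒜 g = ⊤) (hE : IsGradedModule 𝒜 ℰ)
    (H : ∀ (Y : Type u) [AddCommGroup Y] [Module R Y] (𝒴 : G → AddSubgroup Y)
      (hY : IsGradedModule 𝒜 𝒴) (f : Y →ₗ.[R] E), IsHomogPMap hY ℰ f →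
      ∀ g, ∀ y ∈ 𝒴 g, ∃ e ∈ ℰ g, ∀ (r : R) (h : r • y ∈ f.domain), f ⟨r • y, h⟩ = r • e) :
    IsStarInjective 𝒜 ℰ := by
  intro X Y _ _ _ _ 𝒳 𝒴 hX hY i f hi hinj hf
  let f₀ : Y →ₗ.[R] E := ⟨LinearMap.range i, f ∘ₗ (LinearEquiv.ofInjective i hinj).symm.toLinearMap⟩
  have hf₀i : ∀ (x : X) (z : f₀.domain), (z : Y) = i x → f₀ z = f x := fun x z hz =>
    congrArg f ((LinearEquiv.symm_apply_eq _).2 (Subtype.ext hz))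
  have hf₀ : IsHomogPMap hY ℰ f₀ := by
    constructor
    · rintro _ ⟨x, rfl⟩ g
      exact ⟨proj hX.isInternal g x, (hi.proj_map hX.isInternal hY.isInternal g x).symm⟩
    · intro g z hz
      obtain ⟨x, hx⟩ := z.2
      have hx' : i (proj hX.isInternal g x) = i x := by
        rw [← hi.proj_map hX.isInternal hY.isInternal g x, hx]
        exact proj_of_mem _ hz
      rw [hf₀i x z hx.symm, ← hinj hx']
      exact hf.mem (proj_mem _ _ _)
  -- Zorn's lemma for the homogeneous extensions of `f₀`: the union of a chain is again homogeneous,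
  -- since each condition concerns one element of the domain.
  obtain ⟨m, hm₀, hm, hmax⟩ := zorn_le_nonempty₀ {f : Y →ₗ.[R] E | IsHomogPMap hY ℰ f} (by
    intro c hc hchain y hyc
    have hne : c.Nonempty := ⟨y, hyc⟩
    refine ⟨LinearPMap.sSup c hchain.directedOn, ⟨?_, ?_⟩,
      fun z hz => LinearPMap.le_sSup hchain.directedOn hz⟩
    · intro x hx g
      rw [LinearPMap.mem_domain_sSup_iff hne] at hx ⊢
      obtain ⟨q, hq, hxq⟩ := hx
      exact ⟨q, hq, (hc hq).proj_mem x hxq g⟩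
    · rintro g ⟨x, hx⟩ hxg
      obtain ⟨q, hq, hxq⟩ := (LinearPMap.mem_domain_sSup_iff hne hchain.directedOn).1 hx
      have := (LinearPMap.le_sSup hchain.directedOn hq).2 (x := ⟨x, hxq⟩) (y := ⟨x, hx⟩) rfl
      rw [← this]
      exact (hc hq).map_mem g ⟨x, hxq⟩ hxg) f₀ hf₀
  have hmem : ∀ g, ∀ y ∈ 𝒴 g, y ∈ m.domain := by
    intro g y hy
    obtain ⟨e, he, hre⟩ := H Y 𝒴 hY m hm g y hy
    -- This makes y ↦ e well defined on the span of `y`, so that it can be glued to `m`.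
    have hzero : ∀ c : R, c • y = 0 → c • e = 0 := by
      intro c hc
      have h0 : c • y ∈ m.domain := hc ▸ m.domain.zero_mem
      rw [← hre c h0, ← m.map_zero]
      congr 1
      exact Subtype.ext hc
    let q : Y →ₗ.[R] E := LinearPMap.mkSpanSingleton' y e hzero
    have hq : ∀ (c : R) (z : q.domain), (z : Y) = c • y → q z = c • e := by
      rintro c ⟨_, hz⟩ rfl
      exact LinearPMap.mkSpanSingleton'_apply y e hzero c hz
    have hmq : ∀ (x : m.domain) (z : q.domain), (x : Y) = z → m x = q z := by
      rintro ⟨x, hx⟩ ⟨z, hz⟩ hxz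
      obtain ⟨c, rfl⟩ := Submodule.mem_span_singleton.1 hz
      obtain rfl : x = c • y := hxz
      rw [hq c _ rfl, hre]
    -- The enlarged domain is graded, and in degree `k` the coefficient of `y` can be taken
    -- homogeneous, which puts its multiple of `e` in degree `k`.
    have hdom : ∀ x ∈ (m.sup q hmq).domain, ∀ k, ∃ (z : m.domain) (c : R),
        (z : Y) ∈ 𝒴 k ∧ c ∈ 𝒜 (k - g) ∧ proj hY.isInternal k x = z + c • y := by
      intro x hx k
      obtain ⟨z, hz, w, hw, rfl⟩ := Submodule.mem_sup.1 hx
      obtain ⟨c, rfl⟩ := Submodule.mem_span_singleton.1 hw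
      obtain ⟨c', hc', hcc'⟩ := hY.exists_proj_smul_eq h𝒜 hy c k
      exact ⟨⟨_, hm.proj_mem z hz k⟩, c', proj_mem _ _ _, hc', by rw [map_add, hcc']⟩
    have hsup : IsHomogPMap hY ℰ (m.sup q hmq) := by
      constructor
      · intro x hx k
        obtain ⟨z, c, -, -, hzc⟩ := hdom x hx k
        rw [hzc]
        exact Submodule.add_mem_sup z.2 (Submodule.mem_span_singleton.2 ⟨c, rfl⟩)
      · intro k x hx
        obtain ⟨z, c, hz, hc, hzc⟩ := hdom x x.2 k
        rw [proj_of_mem _ hx] at hzc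
        let w : q.domain := ⟨c • y, Submodule.mem_span_singleton.2 ⟨c, rfl⟩⟩
        rw [LinearPMap.sup_apply hmq z w x hzc.symm, hq c w rfl]
        refine add_mem (hm.map_mem k z hz) ?_
        have := hE.smul_mem hc he
        rwa [add_sub_cancel] at this
    exact (hmax hsup (LinearPMap.left_le_sup _ _ _)).1
      (Submodule.mem_sup_right (Submodule.mem_span_singleton_self y))
  have htop : ∀ y, y ∈ m.domain :=
    homogeneous_induction hY.isInternal (zero_mem _) (fun _ _ => add_mem) hmem
  refine ⟨m.toFun ∘ₗ LinearMap.codRestrict m.domain LinearMap.id htop,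
    IsHomog.of_mem fun g y hy => hm.map_mem g ⟨y, _⟩ hy, ?_⟩
  ext x
  have := hm₀.2 (x := ⟨i x, ⟨x, rfl⟩⟩) (y := ⟨i x, htop _⟩) rfl
  exact this.symm.trans (hf₀i x _ rfl)

/-- A homogeneous homomorphism into a *injective module that vanishes on the kernel of a
homogeneous homomorphism factors through the latter. -/
theorem IsStarInjective.exists_comp_eq (hE : IsStarInjective 𝒜 ℰ)
    {B C : Type u} [AddCommGroup B] [Module R B] [AddCommGroup C] [Module R C]
    {ℬ : G → AddSubgroup B} {𝒞 : G → AddSubgroup C}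
    (hB : IsGradedModule 𝒜 ℬ) (hC : IsGradedModule 𝒜 𝒞)
    {b : B →ₗ[R] C} {v : B →ₗ[R] E} (hb : IsHomog ℬ 𝒞 b) (hv : IsHomog ℬ ℰ v)
    (hker : ∀ x, b x = 0 → v x = 0) : ∃ w : C →ₗ[R] E, IsHomog 𝒞 ℰ w ∧ w ∘ₗ b = v := by
  let L : Submodule R C := LinearMap.range b
  have hL : IsGradedModule 𝒜 (subGrading 𝒞 L) := hC.submodule (by
    rintro _ ⟨x, rfl⟩ g
    exact ⟨proj hB.isInternal g x, (hb.proj_map hB.isInternal hC.isInternal g x).symm⟩)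
  let v' : L →ₗ[R] E :=
    (LinearMap.ker b).liftQ v (fun x hx => hker x hx) ∘ₗ b.quotKerEquivRange.symm.toLinearMap
  have hv' : ∀ (x : B) (z : L), (z : C) = b x → v' z = v x := by
    intro x z hz
    have : b.quotKerEquivRange.symm z = Submodule.Quotient.mk x :=
      (LinearEquiv.symm_apply_eq _).2 (Subtype.ext hz)
    exact congrArg ((LinearMap.ker b).liftQ v fun x hx => hker x hx) this
  have hv'h : IsHomog (subGrading 𝒞 L) ℰ v' := by
    refine IsHomog.of_mem ?_
    intro g z hz
    obtain ⟨x, hx⟩ := z.2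
    -- A preimage of a homogeneous element need not be homogeneous, but it differs from its
    -- component of degree `g` by an element of the kernel of `b`, where `v` vanishes.
    have hxg : b (proj hB.isInternal g x) = b x := by
      rw [← hb.proj_map hB.isInternal hC.isInternal g x, hx]
      exact proj_of_mem _ hz
    rw [hv' x z hx.symm, ← sub_add_cancel x (proj hB.isInternal g x), map_add,
      hker _ (by rw [map_sub, hxg, sub_self]), zero_add]
    exact hv.mem (proj_mem _ _ _)
  obtain ⟨w, hw, hwL⟩ := hE L C (subGrading 𝒞 L) 𝒞 hL hC L.subtype v'
    (IsHomog.of_mem fun g x hx => hx) L.injective_subtype hv'h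
  refine ⟨w, hw, LinearMap.ext fun x => ?_⟩
  rw [← hv' x ⟨b x, x, rfl⟩ rfl, ← hwL]
  rfl

end Extension


/-! ### Comparison maps and homotopies between *injective resolutions. -/

section Comparison

/-- Recursive construction of chain maps and homotopies. The property `P` travels along the
recursion because the next map exists only when the current one has it; `Q` records the link between
consecutive maps. -/
theorem exists_dependent_sequence {X : ℕ → Type*} (P : ∀ i, X i → Prop)
    (Q : ∀ i, X i → X (i + 1) → Prop) (x₀ : X 0) (h₀ : P 0 x₀)
    (hs : ∀ i x, P i x → ∃ y, P (i + 1) y ∧ Q i x y) :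
    ∃ f : ∀ i, X i, f 0 = x₀ ∧ (∀ i, P i (f i)) ∧ ∀ i, Q i (f i) (f (i + 1)) := by
  choose next hP hQ using hs
  let F : ∀ i, {x : X i // P i x} := fun i =>
    Nat.rec ⟨x₀, h₀⟩ (fun i x => ⟨next i x.1 x.2, hP i x.1 x.2⟩) i
  exact ⟨fun i => (F i).1, rfl, fun i => (F i).2, fun i => hQ i (F i).1 (F i).2⟩

variable {G : Type*} [AddCommGroup G] [DecidableEq G]
variable {R : Type u} [CommRing R] {𝒜 : G → AddSubgroup R}
variable {N : Type u} [AddCommGroup N] [Module R N] {𝒩 : G → AddSubgroup N}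

namespace StarInjectiveResolution

theorem d_d (J : StarInjectiveResolution 𝒜 𝒩) (i : ℕ) (x : J.obj i) : J.d (i + 1) (J.d i x) = 0 :=
  (J.exact_succ i).apply_apply_eq_zero x

/-- The identity of `N` extends to a homogeneous morphism of *injective resolutions. -/
theorem exists_chainMap (hN : IsGradedModule 𝒜 𝒩) (J K : StarInjectiveResolution 𝒜 𝒩) :
    ∃ f : ∀ i, J.obj i →ₗ[R] K.obj i, (∀ x, f 0 (J.ι x) = K.ι x) ∧
      (∀ i, IsHomog (J.grading i) (K.grading i) (f i)) ∧
      ∀ i x, f (i + 1) (J.d i x) = K.d i (f i x) := by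
  obtain ⟨f₀, hf₀, hf₀ι⟩ := (K.injective 0).exists_comp_eq hN (J.graded 0) J.homog_ι K.homog_ι
    (fun x hx => by rw [J.mono_ι (hx.trans (map_zero J.ι).symm), map_zero])
  obtain ⟨f, hf0, hfP, hfQ⟩ := exists_dependent_sequence
    (X := fun i => J.obj i →ₗ[R] K.obj i)
    (fun i f => IsHomog (J.grading i) (K.grading i) f ∧ ∀ x, J.d i x = 0 → K.d i (f x) = 0)
    (fun i f f' => f' ∘ₗ J.d i = K.d i ∘ₗ f) f₀
    ⟨hf₀, fun x hx => by
      obtain ⟨y, rfl⟩ := (J.exact_zero x).1 hx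
      change K.d 0 ((f₀ ∘ₗ J.ι) y) = 0
      rw [hf₀ι]
      exact K.exact_zero.apply_apply_eq_zero y⟩
    (by
      rintro i f ⟨hf, hk⟩
      obtain ⟨f', hf', hff'⟩ := (K.injective (i + 1)).exists_comp_eq (J.graded i)
        (J.graded (i + 1)) (J.homog_d i) ((K.homog_d i).comp hf) hk
      refine ⟨f', ⟨hf', fun x hx => ?_⟩, hff'⟩
      obtain ⟨y, rfl⟩ := (J.exact_succ i x).1 hx
      change K.d (i + 1) ((f' ∘ₗ J.d i) y) = 0
      rw [hff']
      exact K.d_d i _)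
  refine ⟨f, fun x => ?_, fun i => (hfP i).1, fun i x => LinearMap.congr_fun (hfQ i) x⟩
  rw [hf0]
  exact LinearMap.congr_fun hf₀ι x

/-- A homogeneous morphism of *injective resolutions that vanishes on `N` is homotopic to zero. -/
theorem exists_homotopy {J K : StarInjectiveResolution 𝒜 𝒩} (f : ∀ i, J.obj i →ₗ[R] K.obj i)
    (hf₀ : ∀ x, f 0 (J.ι x) = 0) (hf : ∀ i, IsHomog (J.grading i) (K.grading i) (f i))
    (hfd : ∀ i x, f (i + 1) (J.d i x) = K.d i (f i x)) :
    ∃ h : ∀ i, J.obj (i + 1) →ₗ[R] K.obj i, (∀ x, f 0 x = h 0 (J.d 0 x)) ∧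
      ∀ i x, f (i + 1) x = h (i + 1) (J.d (i + 1) x) + K.d i (h i x) := by
  obtain ⟨h₀, hh₀, hhf⟩ := (K.injective 0).exists_comp_eq (J.graded 0) (J.graded 1) (J.homog_d 0)
    (hf 0) (fun x hx => by
      obtain ⟨y, rfl⟩ := (J.exact_zero x).1 hx
      exact hf₀ y)
  obtain ⟨h, hh0, -, hhQ⟩ := exists_dependent_sequence
    (X := fun i => J.obj (i + 1) →ₗ[R] K.obj i)
    (fun i h => IsHomog (J.grading (i + 1)) (K.grading i) h ∧
      ∀ x, K.d i (h (J.d i x)) = K.d i (f i x))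
    -- The second clause of the invariant says that `f (i + 1) - K.d i ∘ h` vanishes on the image of
    -- `J.d i`, the kernel of `J.d (i + 1)`; the difference therefore factors through that
    -- differential.
    (fun i h h' => h' ∘ₗ J.d (i + 1) = f (i + 1) - K.d i ∘ₗ h) h₀
    ⟨hh₀, fun x => congrArg (K.d 0) (LinearMap.congr_fun hhf x)⟩
    (by
      rintro i h ⟨hh, hk⟩
      obtain ⟨h', hh', hhh'⟩ := (K.injective (i + 1)).exists_comp_eq (J.graded (i + 1))
        (J.graded (i + 2)) (J.homog_d (i + 1)) ((hf (i + 1)).sub ((K.homog_d i).comp hh))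
        (fun x hx => by
          obtain ⟨y, rfl⟩ := (J.exact_succ i x).1 hx
          rw [LinearMap.sub_apply, LinearMap.comp_apply, hk, hfd, sub_self])
      refine ⟨h', ⟨hh', fun x => ?_⟩, hhh'⟩
      have := LinearMap.congr_fun hhh' x
      rw [LinearMap.comp_apply] at this
      rw [this, LinearMap.sub_apply, map_sub, LinearMap.comp_apply, K.d_d, sub_zero])
  refine ⟨h, fun x => ?_, fun i x => ?_⟩
  · rw [hh0]
    exact (LinearMap.congr_fun hhf x).symm
  · have := LinearMap.congr_fun (hhQ i) x
    rw [LinearMap.comp_apply, LinearMap.sub_apply, LinearMap.comp_apply] at this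
    rw [this, sub_add_cancel]

end StarInjectiveResolution

end Comparison

/-! ### *Ext of R/I as the elements annihilated by I. -/

section Torsion

variable {R : Type u} [CommRing R] (I : Ideal R)
variable {M : Type u} [AddCommGroup M] [Module R M]

/-- The homomorphism `R/I → M` with `1 ↦ x`, for `x` annihilated by `I`. -/
def quotHom : Submodule.torsionBySet R M (I : Set R) →ₗ[R] ((R ⧸ I) →ₗ[R] M) where
  toFun x := Submodule.liftQ I (LinearMap.toSpanSingleton R M x) fun a ha =>
    (Submodule.mem_torsionBySet_iff _ _).1 x.2 ⟨a, ha⟩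
  map_add' x y := by
    refine Submodule.linearMap_qext _ (LinearMap.ext fun r => ?_)
    exact smul_add r (x : M) y
  map_smul' r x := by
    refine Submodule.linearMap_qext _ (LinearMap.ext fun r' => ?_)
    exact smul_comm r' r (x : M)

theorem quotHom_mk (x : Submodule.torsionBySet R M (I : Set R)) (r : R) :
    quotHom I x (Ideal.Quotient.mk I r) = r • (x : M) := rfl

theorem quotHom_one (x : Submodule.torsionBySet R M (I : Set R)) : quotHom I x 1 = x :=
  (quotHom_mk I x 1).trans (one_smul R _)

variable {I} in
theorem quot_hom_ext {f f' : (R ⧸ I) →ₗ[R] M} (h : f 1 = f' 1) : f = f' :=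
  Submodule.linearMap_qext _ (LinearMap.ext_ring h)

theorem apply_one_mem_torsionBySet (f : (R ⧸ I) →ₗ[R] M) :
    f 1 ∈ Submodule.torsionBySet R M (I : Set R) := by
  rw [Submodule.mem_torsionBySet_iff]
  rintro ⟨a, ha⟩
  have : a • (1 : R ⧸ I) = 0 := by
    rw [Algebra.smul_def, mul_one]
    exact Ideal.Quotient.eq_zero_iff_mem.2 ha
  rw [← map_smul, this, map_zero]

theorem map_mem_torsionBySet {M' : Type u} [AddCommGroup M'] [Module R M'] (f : M →ₗ[R] M')
    {x : M} (hx : x ∈ Submodule.torsionBySet R M (I : Set R)) :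
    f x ∈ Submodule.torsionBySet R M' (I : Set R) := by
  rw [Submodule.mem_torsionBySet_iff] at hx ⊢
  intro a
  rw [← map_smul, hx, map_zero]

variable {G : Type*} [AddCommGroup G] [DecidableEq G] {𝒜 : G → AddSubgroup R}
variable {ℳ : G → AddSubgroup M}

theorem quotHom_mem_starHomDeg (hM : IsGradedModule 𝒜 ℳ) {g : G}
    (x : Submodule.torsionBySet R M (I : Set R)) (hx : (x : M) ∈ ℳ g) :
    quotHom I x ∈ starHomDeg (quotGrading 𝒜 I) ℳ g := by
  rintro k _ ⟨r, hr, rfl⟩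
  have := hM.smul_mem hr hx
  rw [add_comm] at this
  exact this

/-- The elements annihilated by a graded ideal form a graded submodule. -/
theorem proj_mem_torsionBySet {s : Set R} (hs : ∀ a ∈ s, ∃ g, a ∈ 𝒜 g) (hM : IsGradedModule 𝒜 ℳ)
    {x : M} (hx : x ∈ Submodule.torsionBySet R M (Ideal.span s : Set R)) (g : G) :
    proj hM.isInternal g x ∈ Submodule.torsionBySet R M (Ideal.span s : Set R) := by
  rw [Submodule.mem_torsionBySet_iff] at hx ⊢
  rintro ⟨a, ha⟩
  have hle : Ideal.span s ≤ LinearMap.ker (LinearMap.toSpanSingleton R M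
      (proj hM.isInternal g x)) := by
    rw [Ideal.span_le]
    intro a ha
    obtain ⟨k, hk⟩ := hs a ha
    change a • proj hM.isInternal g x = 0
    rw [← hM.proj_smul hk, hx ⟨a, Ideal.subset_span ha⟩, map_zero]
  exact hle ha

/-- As R/I is cyclic, a homomorphism out of it is determined by the image of 1. The finitely many
components of this image are again killed by the graded ideal `I`, and they split the homomorphism
into homogeneous ones. -/
theorem quotHom_mem_starHom {s : Set R} (hs : ∀ a ∈ s, ∃ g, a ∈ 𝒜 g) (hI : I = Ideal.span s)
    (hM : IsGradedModule 𝒜 ℳ) (x : Submodule.torsionBySet R M (I : Set R)) :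
    quotHom I x ∈ starHom (quotGrading 𝒜 I) ℳ := by
  subst hI
  obtain ⟨t, ht⟩ := exists_eq_sum_proj hM.isInternal (x : M)
  have : x = ∑ g ∈ t, ⟨_, proj_mem_torsionBySet hs hM x.2 g⟩ := by
    refine Subtype.ext ?_
    rw [AddSubmonoidClass.coe_finsetSum]
    exact ht
  rw [this, map_sum]
  exact sum_mem fun g _ => Submodule.subset_span
    ⟨g, quotHom_mem_starHomDeg _ hM _ (proj_mem hM.isInternal g _)⟩

variable {N : Type u} [AddCommGroup N] [Module R N] {𝒩 : G → AddSubgroup N}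

/-- If the differentials of a *injective resolution `K` of `N` vanish on the elements annihilated
by the graded ideal `I`, then `*Ext^i(R/I, N)` is the graded module of these elements of `K^i`. -/
theorem exists_starExt_equiv [SetLike.GradedMonoid 𝒜] {s : Set R}
    (hs : ∀ a ∈ s, ∃ g, a ∈ 𝒜 g) (hI : I = Ideal.span s)
    (hN : IsGradedModule 𝒜 𝒩) (J K : StarInjectiveResolution 𝒜 𝒩)
    (hK : ∀ i, ∀ x ∈ Submodule.torsionBySet R (K.obj i) (I : Set R), K.d i x = 0) (i : ℕ) :
    ∃ Ψ : StarExt (quotGrading 𝒜 I) J i ≃ₗ[R] Submodule.torsionBySet R (K.obj i) (I : Set R),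
      ∀ g x, x ∈ StarExt.grading (quotGrading 𝒜 I) J i g ↔ (Ψ x : K.obj i) ∈ K.grading i g := by
  obtain ⟨f, hf₀, hf, hfd⟩ := StarInjectiveResolution.exists_chainMap hN J K
  obtain ⟨f', hf'₀, hf', hf'd⟩ := StarInjectiveResolution.exists_chainMap hN K J
  obtain ⟨h, hh₀, hh⟩ := StarInjectiveResolution.exists_homotopy
    (fun i => f' i ∘ₗ f i - LinearMap.id) (fun x => by simp [hf₀, hf'₀])
    (fun i => ((hf' i).comp (hf i)).sub IsHomog.id) (fun i x => by simp [hfd, hf'd])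
  obtain ⟨h', hh'₀, hh'⟩ := StarInjectiveResolution.exists_homotopy
    (fun i => f i ∘ₗ f' i - LinearMap.id) (fun x => by simp [hf₀, hf'₀])
    (fun i => ((hf i).comp (hf' i)).sub IsHomog.id) (fun i x => by simp [hfd, hf'd])
  have hcoc : ∀ z ∈ starCocycles (quotGrading 𝒜 I) J i, J.d i (z 1) = 0 := fun z hz =>
    LinearMap.congr_fun (LinearMap.mem_ker.1 hz.2) 1
  -- Both homotopy terms vanish here: `K.d` kills `w`, and it kills `h' i w`, which is again
  -- annihilated by `I`. So `f ∘ f'` is the identity on these elements, not merely up to homotopy.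
  have hff' : ∀ w ∈ Submodule.torsionBySet R (K.obj i) (I : Set R), f i (f' i w) = w := by
    intro w hw
    rw [← sub_eq_zero]
    cases i with
    | zero => simpa [hK 0 w hw] using hh'₀ w
    | succ i =>
      simpa [hK (i + 1) w hw, hK i (h' i w) (map_mem_torsionBySet I (h' i) hw)] using hh' i w
  have hcob : ∀ z ∈ starCoboundaries (quotGrading 𝒜 I) J i, f i (z 1) = 0 := by
    intro z hz
    cases i with
    | zero => rw [(Submodule.mem_bot R).1 hz]; simp
    | succ i =>
      obtain ⟨w, -, rfl⟩ := hz
      change f (i + 1) (J.d i (w 1)) = 0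
      rw [hfd]
      exact hK i _ (map_mem_torsionBySet I _ (apply_one_mem_torsionBySet I w))
  -- The homotopy on `J` gives `-z 1 = J.d i (h i (z 1))` in degree `i + 1`, so the cochain
  -- determined by `-h i (z 1)` bounds `z`. In degree 0 the same identity gives `z 1 = 0`.
  have hinj : ∀ z ∈ starCocycles (quotGrading 𝒜 I) J i, f i (z 1) = 0 →
      z ∈ starCoboundaries (quotGrading 𝒜 I) J i := by
    intro z hz hfz
    have hz0 := hcoc z hz
    have hzt := apply_one_mem_torsionBySet I z
    cases i with
    | zero =>
      have := hh₀ (z 1)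
      simp only [LinearMap.sub_apply, LinearMap.comp_apply, hfz, hz0, map_zero, LinearMap.id_apply,
        zero_sub, neg_eq_zero] at this
      exact (Submodule.mem_bot R).2 (quot_hom_ext this)
    | succ i =>
      have := hh i (z 1)
      simp only [LinearMap.sub_apply, LinearMap.comp_apply, hfz, hz0, map_zero, LinearMap.id_apply,
        zero_sub, zero_add] at this
      refine ⟨quotHom I (-⟨h i (z 1), map_mem_torsionBySet I _ hzt⟩),
        quotHom_mem_starHom I hs hI (J.graded i) _, quot_hom_ext ?_⟩
      change J.d i (quotHom I _ 1) = z 1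
      rw [quotHom_one, Submodule.coe_neg, map_neg, ← this, neg_neg]
  -- A cocycle is evaluated at 1 and carried to `K` by the comparison map.
  let Ψ₀ : starCocycles (quotGrading 𝒜 I) J i →ₗ[R]
      Submodule.torsionBySet R (K.obj i) (I : Set R) :=
    LinearMap.codRestrict _ (f i ∘ₗ LinearMap.applyₗ (1 : R ⧸ I) ∘ₗ Submodule.subtype _)
      fun z => map_mem_torsionBySet I (f i) (apply_one_mem_torsionBySet I z.1)
  have hΨ₀ : ∀ z, (Ψ₀ z : K.obj i) = f i (z.1 1) := fun z => rfl
  let Ψ₁ : StarExt (quotGrading 𝒜 I) J i →ₗ[R]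
      Submodule.torsionBySet R (K.obj i) (I : Set R) :=
    Submodule.liftQ _ Ψ₀ fun z hz => Subtype.ext (hcob z.1 hz)
  have hΨ₁ : ∀ z, Ψ₁ (StarExt.mk (quotGrading 𝒜 I) J i z) = Ψ₀ z := fun z => rfl
  have hmk : ∀ x, ∃ z, StarExt.mk (quotGrading 𝒜 I) J i z = x := Submodule.mkQ_surjective _
  -- The comparison map `f'` yields a cocycle over each `w`, homogeneous whenever `w` is. This gives
  -- surjectivity and also the converse half of the statement on degrees.
  have hsec : ∀ w : Submodule.torsionBySet R (K.obj i) (I : Set R),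
      ∃ z : starCocycles (quotGrading 𝒜 I) J i, Ψ₀ z = w ∧
        ∀ g, (w : K.obj i) ∈ K.grading i g → z.1 ∈ starHomDeg (quotGrading 𝒜 I) (J.grading i) g := by
    intro w
    let y : Submodule.torsionBySet R (J.obj i) (I : Set R) :=
      ⟨f' i w, map_mem_torsionBySet I _ w.2⟩
    refine ⟨⟨quotHom I y, quotHom_mem_starHom I hs hI (J.graded i) y, ?_⟩, Subtype.ext ?_, ?_⟩
    · refine LinearMap.mem_ker.2 (quot_hom_ext ?_)
      change J.d i (quotHom I y 1) = 0
      rw [quotHom_one]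
      change J.d i (f' i w) = 0
      rw [← hf'd, hK i _ w.2, map_zero]
    · rw [hΨ₀, quotHom_one]
      exact hff' w w.2
    · exact fun g hg => quotHom_mem_starHomDeg I (J.graded i) y ((hf' i).mem hg)
  have hbij : Function.Bijective Ψ₁ := by
    constructor
    · rw [injective_iff_map_eq_zero]
      intro x hx
      obtain ⟨z, rfl⟩ := hmk x
      exact (Submodule.Quotient.mk_eq_zero _).2 (hinj z.1 z.2 (congrArg Subtype.val hx))
    · intro w
      obtain ⟨z, hz, -⟩ := hsec w
      exact ⟨StarExt.mk (quotGrading 𝒜 I) J i z, hz⟩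
  refine ⟨LinearEquiv.ofBijective Ψ₁ hbij, fun g x => ⟨?_, fun hx => ?_⟩⟩
  · rintro ⟨z, hz, rfl⟩
    change f i (z.1 1) ∈ K.grading i g
    refine (hf i).mem ?_
    have := hz 0 1 ⟨1, SetLike.GradedOne.one_mem, map_one (Ideal.Quotient.mk I)⟩
    rwa [zero_add] at this
  · obtain ⟨z, hz, hzg⟩ := hsec (Ψ₁ x)
    refine ⟨z, hzg g hx, hbij.1 ?_⟩
    exact hz

end Torsion


/-! ### Homogeneous localization of graded modules and of *injectives. -/

section Localization

variable {G : Type*} [AddCommGroup G] [DecidableEq G]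
variable {R : Type u} [CommRing R] {𝒜 : G → AddSubgroup R} [GradedRing 𝒜]
variable (p : Ideal R) [p.IsPrime]
variable {M : Type u} [AddCommGroup M] [Module R M] {ℳ : G → AddSubgroup M}

theorem isGradedModule_self (𝒜 : G → AddSubgroup R) [GradedRing 𝒜] : IsGradedModule 𝒜 𝒜 where
  gradedSMul := inferInstance
  isInternal := DirectSum.Decomposition.isInternal 𝒜

theorem isGradedModule_of_decomposition (𝒜 : G → AddSubgroup R) (ℳ : G → AddSubgroup M)
    [DirectSum.Decomposition ℳ] [SetLike.GradedSMul 𝒜 ℳ] : IsGradedModule 𝒜 ℳ where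
  gradedSMul := inferInstance
  isInternal := DirectSum.Decomposition.isInternal ℳ

variable {p} in
theorem homogCompl.exists_degree (s : homogCompl 𝒜 p) : ∃ k, (s : R) ∈ 𝒜 k := s.2.1

variable {p} in
theorem mem_homogCompl {s : R} {k : G} (hs : s ∈ 𝒜 k) (hsp : s ∉ p) : s ∈ homogCompl 𝒜 p :=
  ⟨⟨k, hs⟩, hsp⟩

variable {p} in
theorem localizedModule_mk_eq_zero {m : M} {s : homogCompl 𝒜 p} :
    LocalizedModule.mk m s = 0 ↔ ∃ t : homogCompl 𝒜 p, (t : R) • m = 0 := by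
  rw [← LocalizedModule.zero_mk 1, LocalizedModule.mk_eq]
  simp only [one_smul, smul_zero]
  rfl

variable {p} in
theorem mk_mem_locModuleGrading [SetLike.GradedSMul 𝒜 ℳ] {g k : G} {m : M} {s : homogCompl 𝒜 p}
    (hm : m ∈ ℳ (g + k)) (hs : (s : R) ∈ 𝒜 k) :
    (LocalizedModule.mk m s : HomogLocModule 𝒜 p M) ∈ locModuleGrading 𝒜 p ℳ g :=
  ⟨k, m, s, hm, hs, rfl⟩

variable {p} in
theorem mk_one_mem_locModuleGrading [SetLike.GradedSMul 𝒜 ℳ] {g : G} {m : M} (hm : m ∈ ℳ g) :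
    (LocalizedModule.mk m 1 : HomogLocModule 𝒜 p M) ∈ locModuleGrading 𝒜 p ℳ g :=
  mk_mem_locModuleGrading (k := 0) (by rwa [add_zero]) SetLike.GradedOne.one_mem

theorem iSup_locGrading (𝒜 : G → AddSubgroup R) [GradedRing 𝒜] (p : Ideal R) [p.IsPrime] :
    ⨆ g, locGrading 𝒜 p g = ⊤ := by
  rw [eq_top_iff]
  intro x _
  induction x using Localization.induction_on with
  | H x =>
    obtain ⟨r, s⟩ := x
    obtain ⟨k, hk⟩ := homogCompl.exists_degree s
    refine homogeneous_induction (isGradedModule_self 𝒜).isInternal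
      (P := fun r => Localization.mk r s ∈ ⨆ g, locGrading 𝒜 p g) ?_ ?_ ?_ r
    · rw [Localization.mk_zero]
      exact zero_mem _
    · intro x y hx hy
      rw [← Localization.add_mk_self]
      exact add_mem hx hy
    · intro g x hx
      exact AddSubgroup.mem_iSup_of_mem (g - k) ⟨k, x, s, by rwa [sub_add_cancel], hk, rfl⟩

/-- For directness of the sum, finitely many homogeneous fractions are put over one homogeneous
denominator; they become the components of a single numerator. If the sum is zero, one homogeneous
element of the multiplicative set kills this numerator, hence all its components. -/
theorem IsGradedModule.localized [SetLike.GradedSMul 𝒜 ℳ] (hM : IsGradedModule 𝒜 ℳ) :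
    IsGradedModule (locGrading 𝒜 p) (locModuleGrading 𝒜 p ℳ) := by
  refine .of_smul_mem ?_ ⟨?_, ?_⟩
  · rintro g k _ _ ⟨l, a, s, ha, hs, rfl⟩ ⟨l', m, t, hm, ht, rfl⟩
    rw [LocalizedModule.mk_smul_mk]
    refine mk_mem_locModuleGrading (k := l + l') ?_ (SetLike.GradedMul.mul_mem hs ht)
    have := hM.smul_mem ha hm
    rwa [show k + l' + (g + l) = k + g + (l + l') by abel] at this
  · rw [injective_iff_map_eq_zero]
    have key : ∀ x : ⨁ g, locModuleGrading 𝒜 p ℳ g, ∃ (k : G) (s : homogCompl 𝒜 p) (m : M),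
        (s : R) ∈ 𝒜 k ∧ DirectSum.coeAddMonoidHom _ x = LocalizedModule.mk m s ∧
        ∀ g, (x g : HomogLocModule 𝒜 p M) =
          LocalizedModule.mk (proj hM.isInternal (g + k) m) s := by
      intro x
      induction x using DirectSum.induction_on with
      | zero =>
        exact ⟨0, 1, 0, SetLike.GradedOne.one_mem, by simp,
          fun g => by simp⟩
      | of g x =>
        obtain ⟨_, k, m, s, hm, hs, rfl⟩ := x
        refine ⟨k, s, m, hs, DirectSum.coeAddMonoidHom_of _ _ _, fun g' => ?_⟩
        by_cases hg : g' = g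
        · subst hg
          rw [DirectSum.of_eq_same, proj_of_mem _ hm]
        · rw [DirectSum.of_eq_of_ne _ _ _ hg, proj_of_ne _ (fun h => hg (add_right_cancel h)) hm,
            LocalizedModule.zero_mk]
          rfl
      | add x y hx hy =>
        obtain ⟨k, s, m, hs, hxm, hxg⟩ := hx
        obtain ⟨k', s', m', hs', hym, hyg⟩ := hy
        refine ⟨k + k', s * s', s' • m + s • m', SetLike.GradedMul.mul_mem hs hs', ?_, fun g => ?_⟩
        · rw [map_add, hxm, hym, LocalizedModule.mk_add_mk]
        · have h1 : proj hM.isInternal (g + (k + k')) ((s' : R) • m) =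
              (s' : R) • proj hM.isInternal (g + k) m := by
            rw [← hM.proj_smul hs', add_assoc]
          have h2 : proj hM.isInternal (g + (k + k')) ((s : R) • m') =
              (s : R) • proj hM.isInternal (g + k') m' := by
            rw [← hM.proj_smul hs, add_comm k, add_assoc]
          rw [map_add]
          change (x g + y g : HomogLocModule 𝒜 p M) = LocalizedModule.mk
            (proj hM.isInternal (g + (k + k')) ((s' : R) • m) +
              proj hM.isInternal (g + (k + k')) ((s : R) • m')) (s * s')
          rw [hxg, hyg, LocalizedModule.mk_add_mk, h1, h2]
          rfl
    intro x hx
    obtain ⟨k, s, m, hs, hxm, hxg⟩ := key x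
    rw [hx] at hxm
    obtain ⟨t, ht⟩ := localizedModule_mk_eq_zero.1 hxm.symm
    obtain ⟨l, hl⟩ := homogCompl.exists_degree t
    refine DFinsupp.ext fun g => Subtype.ext ?_
    rw [hxg]
    refine localizedModule_mk_eq_zero.2 ⟨t, ?_⟩
    rw [← hM.proj_smul hl, ht, map_zero]
  · rw [← AddMonoidHom.range_eq_top, eq_top_iff]
    intro x _
    induction x using LocalizedModule.induction_on with
    | h m s =>
    obtain ⟨k, hk⟩ := homogCompl.exists_degree s
    refine homogeneous_induction hM.isInternal
      (P := fun m => LocalizedModule.mk m s ∈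
        (DirectSum.coeAddMonoidHom (locModuleGrading 𝒜 p ℳ)).range) ?_ ?_ ?_ m
    · rw [LocalizedModule.zero_mk]
      exact zero_mem _
    · intro x y hx hy
      have : LocalizedModule.mk (x + y) s = LocalizedModule.mk x s + LocalizedModule.mk y s := by
        rw [LocalizedModule.mk_add_mk, ← smul_add, LocalizedModule.mk_cancel_common_left]
      rw [this]
      exact add_mem hx hy
    · intro g x hx
      exact ⟨DirectSum.of (fun g => locModuleGrading 𝒜 p ℳ g) (g - k) ⟨LocalizedModule.mk x s,
        mk_mem_locModuleGrading (by rwa [sub_add_cancel]) hk⟩, DirectSum.coeAddMonoidHom_of _ _ _⟩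

variable [IsNoetherianRing R] {E : Type u} [AddCommGroup E] [Module R E] {ℰ : G → AddSubgroup E}

/-- Over a Noetherian graded ring, homogeneous localization preserves *injective modules. -/
theorem IsStarInjective.localized [SetLike.GradedSMul 𝒜 ℰ] (hE : IsGradedModule 𝒜 ℰ)
    (hinj : IsStarInjective 𝒜 ℰ) :
    IsStarInjective (locGrading 𝒜 p) (locModuleGrading 𝒜 p ℰ) := by
  refine isStarInjective_of_extend (iSup_locGrading 𝒜 p) (hE.localized p) ?_
  intro Y _ _ 𝒴 hY f hf g y hy
  have hloc : ∀ {k : G} {r : R}, r ∈ 𝒜 k → algebraMap R (HomogLoc 𝒜 p) r ∈ locGrading 𝒜 p k :=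
    fun {k r} hr => ⟨0, r, 1, by rwa [add_zero], SetLike.GradedOne.one_mem, rfl⟩
  have hsE : ∀ (r : R) (z : HomogLocModule 𝒜 p E), algebraMap R (HomogLoc 𝒜 p) r • z = r • z :=
    fun r z => algebraMap_smul _ r z
  have hself := isGradedModule_self 𝒜
  -- The problem over R_(p) is brought down to `R`: 𝔟 consists of the r with r/1 · y in the domain
  -- of `f`, and `q` below sends r to the value of `f` there.
  let 𝔟 : Ideal R :=
    { carrier := {r | algebraMap R (HomogLoc 𝒜 p) r • y ∈ f.domain}
      add_mem' := fun {a b} ha hb => by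
        change algebraMap R (HomogLoc 𝒜 p) (a + b) • y ∈ f.domain
        rw [map_add, add_smul]
        exact add_mem ha hb
      zero_mem' := by
        change algebraMap R (HomogLoc 𝒜 p) 0 • y ∈ f.domain
        rw [map_zero, zero_smul]
        exact zero_mem _
      smul_mem' := fun c a ha => by
        change algebraMap R (HomogLoc 𝒜 p) (c * a) • y ∈ f.domain
        rw [map_mul, mul_smul]
        exact f.domain.smul_mem _ ha }
  have h𝔟 : ∀ b ∈ 𝔟, ∀ k, proj hself.isInternal k b ∈ 𝔟 := by
    intro b hb k
    have := proj_map hself.isInternal hY.isInternal (a := g)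
      (((smulAddHom (HomogLoc 𝒜 p) Y).flip y).comp
        (algebraMap R (HomogLoc 𝒜 p)).toAddMonoidHom)
      (fun k r hr => by
        have := hY.smul_mem (hloc hr) hy
        rwa [add_comm] at this) k b
    change algebraMap R (HomogLoc 𝒜 p) (proj hself.isInternal k b) • y ∈ f.domain
    have h2 : algebraMap R (HomogLoc 𝒜 p) (proj hself.isInternal k b) • y =
      proj hY.isInternal (k + g) (algebraMap R (HomogLoc 𝒜 p) b • y) := this.symm
    rw [h2]
    exact hf.proj_mem _ hb _
  have h𝔟g : IsGradedModule 𝒜 (subGrading 𝒜 𝔟) := hself.submodule h𝔟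
  let q : 𝔟 →ₗ[R] HomogLocModule 𝒜 p E :=
    { toFun := fun b => f ⟨algebraMap R (HomogLoc 𝒜 p) b • y, b.2⟩
      map_add' := fun a b => by
        rw [← f.map_add]
        congr 1
        refine Subtype.ext ?_
        simp [add_smul]
      map_smul' := fun c a => by
        rw [RingHom.id_apply, ← hsE, ← f.map_smul]
        congr 1
        refine Subtype.ext ?_
        simp [mul_smul] }
  have hq : ∀ k, ∀ b ∈ subGrading 𝒜 𝔟 k, q b ∈ locModuleGrading 𝒜 p ℰ (k + g) := by
    intro k b hb
    refine hf.map_mem _ _ ?_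
    have := hY.smul_mem (hloc hb) hy
    rwa [add_comm] at this
  -- Here the Noetherian hypothesis enters: for finitely presented 𝔟, some multiple `s • q` lifts to
  -- a map from 𝔟 to `E`.
  have : Module.FinitePresentation R 𝔟 := Module.finitePresentation_of_finite R 𝔟
  obtain ⟨h, s, hhs⟩ := Module.FinitePresentation.exists_lift_of_isLocalizedModule
    (homogCompl 𝒜 p) (LocalizedModule.mkLinearMap (homogCompl 𝒜 p) E) q
  obtain ⟨k, hk⟩ := homogCompl.exists_degree s
  -- The lift `h` need not be homogeneous. Since `s • q` has degree `g + k`, the component of `h` of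
  -- that degree still lifts it.
  obtain ⟨h', hh', hh'p⟩ := exists_homogeneous_component
    (iSup_eq_top_of_isInternal hself.isInternal) h𝔟g hE h (g + k)
  have hlift : ∀ b : 𝔟, LocalizedModule.mk (h' b) 1 = (s : R) • q b := by
    intro b
    refine homogeneous_induction h𝔟g.isInternal
      (P := fun b => LocalizedModule.mk (h' b) 1 = (s : R) • q b) ?_ ?_ ?_ b
    · simp
    · intro b c hb hc
      have := (LocalizedModule.mkLinearMap (homogCompl 𝒜 p) E).map_add (h' b) (h' c)
      rw [map_add, map_add, smul_add, ← hb, ← hc]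
      exact this
    · intro l b hb
      have h1 : LocalizedModule.mk (h b) 1 = (s : R) • q b := LinearMap.congr_fun hhs b
      have h2 := IsHomog.proj_map (ℳ := ℰ) (𝒩 := locModuleGrading 𝒜 p ℰ)
        (f := LocalizedModule.mkLinearMap (homogCompl 𝒜 p) E)
        (IsHomog.of_mem fun g m hm => mk_one_mem_locModuleGrading hm) hE.isInternal
        (hE.localized p).isInternal (l + (g + k)) (h b)
      rw [← hh'p l b hb] at h2
      refine Eq.trans h2.symm ?_
      change proj _ _ (LocalizedModule.mk (h b) 1) = _
      rw [h1]
      refine proj_of_mem _ ?_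
      have := (hE.localized p).smul_mem (hloc hk) (hq l b hb)
      rwa [hsE, add_assoc] at this
  -- Shifting by `-(g + k)` turns `h'` into a map of degree 0, to which *injectivity of `E` applies.
  -- The required value at `y` is then `w 1 / s`.
  obtain ⟨w, hw, hwh'⟩ := hinj 𝔟 R (shift (subGrading 𝒜 𝔟) (-(g + k))) (shift 𝒜 (-(g + k)))
    (h𝔟g.shift _) (hself.shift _) 𝔟.subtype h' (IsHomog.of_mem fun _ _ hx => hx)
    𝔟.injective_subtype (IsHomog.of_mem fun l b hb => by
      have := hh' _ b hb
      rwa [neg_add_cancel_right] at this)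
  have hw1 : w 1 ∈ ℰ (g + k) := hw.mem (show (1 : R) ∈ 𝒜 (g + k + -(g + k)) by
    rw [add_neg_cancel]; exact SetLike.GradedOne.one_mem)
  have hwb : ∀ b : 𝔟, h' b = (b : R) • w 1 := by
    intro b
    rw [← map_smul, smul_eq_mul, mul_one, ← hwh']
    rfl
  have hqb : ∀ b : 𝔟, q b = (b : R) • LocalizedModule.mk (w 1) s := by
    intro b
    have h1 := hlift b
    rw [hwb] at h1
    have h2 : (s : R) • ((b : R) • LocalizedModule.mk (w 1) s) =
        LocalizedModule.mk ((b : R) • w 1) 1 := by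
      rw [LocalizedModule.smul'_mk, LocalizedModule.smul'_mk]
      exact LocalizedModule.mk_cancel s _
    exact IsLocalizedModule.smul_injective
      (LocalizedModule.mkLinearMap (homogCompl 𝒜 p) E) s (h1.symm.trans h2.symm)
  refine ⟨LocalizedModule.mk (w 1) s, mk_mem_locModuleGrading hw1 hk, fun r hr => ?_⟩
  -- A general coefficient of R_(p) is reduced to one in 𝔟 by clearing its denominator, which acts
  -- injectively on the localized module.
  obtain ⟨⟨r₀, t⟩, hrt⟩ := IsLocalization.surj (homogCompl 𝒜 p) r
  have hr₀y : algebraMap R (HomogLoc 𝒜 p) t • (r • y) = algebraMap R (HomogLoc 𝒜 p) r₀ • y := by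
    rw [smul_smul, mul_comm, hrt]
  have hr₀ : r₀ ∈ 𝔟 := by
    change algebraMap R (HomogLoc 𝒜 p) r₀ • y ∈ f.domain
    rw [← hr₀y]
    exact f.domain.smul_mem _ hr
  have h3 : algebraMap R (HomogLoc 𝒜 p) t • f ⟨r • y, hr⟩ = q ⟨r₀, hr₀⟩ := by
    rw [← f.map_smul]
    change f _ = f _
    congr 1
    exact Subtype.ext hr₀y
  have h4 : algebraMap R (HomogLoc 𝒜 p) t • (r • LocalizedModule.mk (w 1) s) =
      q ⟨r₀, hr₀⟩ := by
    rw [hqb, smul_smul, mul_comm, hrt, hsE]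
  rw [← h4, hsE, hsE] at h3
  exact IsLocalizedModule.smul_injective
    (LocalizedModule.mkLinearMap (homogCompl 𝒜 p) E) t h3

end Localization


/-! ### Localizing a minimal *injective resolution. -/

section LocalizedResolution

variable {G : Type*} [AddCommGroup G] [DecidableEq G]
variable {R : Type u} [CommRing R] {𝒜 : G → AddSubgroup R}
variable {M : Type u} [AddCommGroup M] [Module R M] {ℳ : G → AddSubgroup M}

theorem IsHomog.proj_mem_range {N : Type u} [AddCommGroup N] [Module R N] {𝒩 : G → AddSubgroup N}
    {f : M →ₗ[R] N} (hf : IsHomog ℳ 𝒩 f) (hM : IsInternal ℳ) (hN : IsInternal 𝒩) :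
    ∀ x ∈ LinearMap.range f, ∀ g, proj hN g x ∈ LinearMap.range f := by
  rintro _ ⟨x, rfl⟩ g
  exact ⟨proj hM g x, (hf.proj_map hM hN g x).symm⟩

theorem localizedModule_map_mk {N : Type u} [AddCommGroup N] [Module R N] (S : Submonoid R)
    (f : M →ₗ[R] N) (m : M) (s : S) :
    LocalizedModule.map S f (LocalizedModule.mk m s) = LocalizedModule.mk (f m) s :=
  IsLocalizedModule.map_LocalizedModules S f m s

variable [GradedRing 𝒜]

/-- A homogeneous nonzero element of a *essential extension of `L` has a nonzero homogeneous
multiple in `L`, if `L` is graded. -/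
theorem IsStarEssential.exists_smul_mem {E : Type u} [AddCommGroup E] [Module R E]
    {ℰ : G → AddSubgroup E} (hE : IsGradedModule 𝒜 ℰ) {L : Submodule R E}
    (hL : ∀ x ∈ L, ∀ g, proj hE.isInternal g x ∈ L) (hess : IsStarEssential ℰ L)
    {g : G} {y : E} (hy : y ∈ ℰ g) (hy0 : y ≠ 0) : ∃ (k : G), ∃ c ∈ 𝒜 k, c • y ∈ L ∧ c • y ≠ 0 := by
  have htop := iSup_eq_top_of_isInternal (isGradedModule_self 𝒜).isInternal
  have hK := hess (Submodule.span R {y}) (isGradedSubmodule_of_proj hE.isInternal (by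
    intro x hx k
    obtain ⟨r, rfl⟩ := Submodule.mem_span_singleton.1 hx
    obtain ⟨c, -, hc⟩ := hE.exists_proj_smul_eq htop hy r k
    exact hc ▸ Submodule.mem_span_singleton.2 ⟨c, rfl⟩))
    (fun h => hy0 (Submodule.span_singleton_eq_bot.1 h))
  obtain ⟨x, ⟨hx, hxL⟩, hx0⟩ := Submodule.exists_mem_ne_zero_of_ne_bot hK
  obtain ⟨r, rfl⟩ := Submodule.mem_span_singleton.1 hx
  -- Each component of `r • y` lies in the graded submodule `L` and is a homogeneous multiple of
  -- `y`; if all such multiples in `L` vanished, `r • y` would be zero.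
  by_contra! hcon
  refine hx0 (eq_zero_of_proj hE.isInternal fun k => ?_)
  obtain ⟨c, hc, hck⟩ := hE.exists_proj_smul_eq htop hy r k
  rw [hck]
  exact hcon _ c hc (hck ▸ hL _ hxL k)

variable (p : Ideal R) [p.IsPrime]

theorem IsHomog.localized {N : Type u} [AddCommGroup N] [Module R N] {𝒩 : G → AddSubgroup N}
    [SetLike.GradedSMul 𝒜 ℳ] [SetLike.GradedSMul 𝒜 𝒩] {f : M →ₗ[R] N} (hf : IsHomog ℳ 𝒩 f) :
    IsHomog (locModuleGrading 𝒜 p ℳ) (locModuleGrading 𝒜 p 𝒩)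
      (LocalizedModule.map (homogCompl 𝒜 p) f) := by
  refine IsHomog.of_mem ?_
  rintro g _ ⟨k, m, s, hm, hs, rfl⟩
  rw [localizedModule_map_mk]
  exact mk_mem_locModuleGrading (hf.mem hm) hs

theorem locIdeal_eq_span (hp : p.IsHomogeneous 𝒜) : ∃ s : Set (HomogLoc 𝒜 p),
    (∀ a ∈ s, ∃ g, a ∈ locGrading 𝒜 p g) ∧ locIdeal 𝒜 p = Ideal.span s := by
  obtain ⟨t, ht⟩ := (Ideal.IsHomogeneous.iff_exists 𝒜 p).1 hp
  refine ⟨algebraMap R (HomogLoc 𝒜 p) '' (Subtype.val '' t), ?_, ?_⟩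
  · rintro _ ⟨_, ⟨⟨a, g, ha⟩, -, rfl⟩, rfl⟩
    exact ⟨g, 0, a, 1, by rwa [add_zero], SetLike.GradedOne.one_mem, rfl⟩
  · exact (congrArg (Ideal.map _) ht).trans (Ideal.map_span _ _)

variable [IsNoetherianRing R]

instance StarInjectiveResolution.gradedSMul (I : StarInjectiveResolution 𝒜 ℳ) (i : ℕ) :
    SetLike.GradedSMul 𝒜 (I.grading i) :=
  (I.graded i).gradedSMul

/-- The homogeneous localization of a *injective resolution. -/
def StarInjectiveResolution.localized [SetLike.GradedSMul 𝒜 ℳ]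
    (I : StarInjectiveResolution 𝒜 ℳ) :
    StarInjectiveResolution (locGrading 𝒜 p) (locModuleGrading 𝒜 p ℳ) where
  obj i := HomogLocModule 𝒜 p (I.obj i)
  grading i := locModuleGrading 𝒜 p (I.grading i)
  graded i := (I.graded i).localized p
  injective i := (I.injective i).localized p (I.graded i)
  ι := LocalizedModule.map (homogCompl 𝒜 p) I.ι
  d i := LocalizedModule.map (homogCompl 𝒜 p) (I.d i)
  homog_ι := I.homog_ι.localized p
  homog_d i := (I.homog_d i).localized p
  mono_ι := LocalizedModule.map_injective (homogCompl 𝒜 p) I.ι I.mono_ι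
  exact_zero := LocalizedModule.map_exact (homogCompl 𝒜 p) _ _ I.exact_zero
  exact_succ i := LocalizedModule.map_exact (homogCompl 𝒜 p) _ _ (I.exact_succ i)

variable {p} in
/-- A homogeneous element of `E_(p)` annihilated by `p` is a fraction whose numerator is
homogeneous and annihilated by `p`. -/
theorem exists_mk_of_mem_torsionBySet {E : Type u} [AddCommGroup E] [Module R E]
    {ℰ : G → AddSubgroup E} [SetLike.GradedSMul 𝒜 ℰ] {g : G}
    {x : HomogLocModule 𝒜 p E} (hx : x ∈ locModuleGrading 𝒜 p ℰ g)
    (hpx : x ∈ Submodule.torsionBySet (HomogLoc 𝒜 p) (HomogLocModule 𝒜 p E)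
      (locIdeal 𝒜 p : Set (HomogLoc 𝒜 p))) :
    ∃ (k : G) (y : E) (s : homogCompl 𝒜 p), y ∈ ℰ (g + k) ∧ (s : R) ∈ 𝒜 k ∧
      x = LocalizedModule.mk y s ∧ ∀ a ∈ p, a • y = 0 := by
  obtain ⟨k, m, s, hm, hs, rfl⟩ := hx
  obtain ⟨F, hF⟩ := (IsNoetherian.noetherian p : p.FG)
  have hkill : ∀ a ∈ p, ∃ t : homogCompl 𝒜 p, (t : R) • a • m = 0 := by
    intro a ha
    rw [← localizedModule_mk_eq_zero (s := s), ← LocalizedModule.smul'_mk,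
      ← algebraMap_smul (HomogLoc 𝒜 p) a]
    exact (Submodule.mem_torsionBySet_iff _ _).1 hpx ⟨_, Ideal.mem_map_of_mem _ ha⟩
  -- Each `a ∈ p` sends `m` to an element killed by some denominator; as `p` is finitely generated,
  -- a product of denominators serves for all of `p` at once.
  have hall : ∀ F : Finset R, (∀ a ∈ F, a ∈ p) →
      ∃ t : homogCompl 𝒜 p, ∀ a ∈ F, (t : R) • a • m = 0 := by
    classical
    intro F
    induction F using Finset.induction_on with
    | empty => exact fun _ => ⟨1, by simp⟩
    | insert b F hb ih =>
      intro hF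
      obtain ⟨t, ht⟩ := ih fun a ha => hF a (Finset.mem_insert_of_mem ha)
      obtain ⟨t', ht'⟩ := hkill b (hF b (Finset.mem_insert_self _ _))
      refine ⟨t * t', fun a ha => ?_⟩
      rw [Submonoid.coe_mul]
      rcases Finset.mem_insert.1 ha with rfl | ha
      · rw [mul_smul, ht', smul_zero]
      · rw [mul_comm, mul_smul, ht a ha, smul_zero]
  obtain ⟨t, ht⟩ := hall F fun a ha => hF ▸ Submodule.subset_span ha
  obtain ⟨l, hl⟩ := homogCompl.exists_degree t
  refine ⟨l + k, (t : R) • m, t * s, ?_, SetLike.GradedMul.mul_mem hl hs,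
    (LocalizedModule.mk_cancel_common_left t s m).symm, fun a ha => ?_⟩
  · have := SetLike.GradedSMul.smul_mem hl hm
    rwa [vadd_eq_add, show l + (g + k) = g + (l + k) by abel] at this
  · have hle : p ≤ LinearMap.ker (LinearMap.toSpanSingleton R E ((t : R) • m)) := by
      refine hF.symm.le.trans (Submodule.span_le.2 fun b hb => ?_)
      change b • (t : R) • m = 0
      rw [smul_comm, ht b hb]
    exact hle ha

/-- The differentials of the localization at `p` of a minimal *injective resolution vanish on the
elements annihilated by `p`. -/
theorem StarInjectiveResolution.IsMinimal.localized_d_eq_zero [SetLike.GradedSMul 𝒜 ℳ]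
    (hM : IsGradedModule 𝒜 ℳ) (hp : p.IsHomogeneous 𝒜)
    {I : StarInjectiveResolution 𝒜 ℳ} (hI : I.IsMinimal) (i : ℕ) :
    ∀ x ∈ Submodule.torsionBySet (HomogLoc 𝒜 p) ((I.localized p).obj i)
      (locIdeal 𝒜 p : Set (HomogLoc 𝒜 p)), (I.localized p).d i x = 0 := by
  have hhom : ∀ g, ∀ x ∈ locModuleGrading 𝒜 p (I.grading i) g,
      x ∈ Submodule.torsionBySet (HomogLoc 𝒜 p) (HomogLocModule 𝒜 p (I.obj i))
        (locIdeal 𝒜 p : Set (HomogLoc 𝒜 p)) →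
      LocalizedModule.map (homogCompl 𝒜 p) (I.d i) x = 0 := by
    intro g x hx hpx
    obtain ⟨k, y, s, hy, hs, rfl, hpy⟩ := exists_mk_of_mem_torsionBySet hx hpx
    rw [localizedModule_map_mk]
    by_cases hy0 : y = 0
    · rw [hy0, map_zero, LocalizedModule.zero_mk]
    -- Essentiality gives a nonzero multiple `c • y` in the image of the preceding map, hence killed
    -- by `I.d i`. As `p` annihilates `y`, `c` lies outside `p` and becomes a unit, so the
    -- differential kills `y` after localization.
    · obtain ⟨l, c, hc, hdc, hcy⟩ : ∃ l, ∃ c ∈ 𝒜 l, I.d i (c • y) = 0 ∧ c • y ≠ 0 := by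
        cases i with
        | zero =>
          obtain ⟨l, c, hc, ⟨z, hz⟩, hcy⟩ := hI.essential_zero.exists_smul_mem (I.graded 0)
            (I.homog_ι.proj_mem_range hM.isInternal _) hy hy0
          exact ⟨l, c, hc, hz ▸ I.exact_zero.apply_apply_eq_zero z, hcy⟩
        | succ i =>
          obtain ⟨l, c, hc, ⟨z, hz⟩, hcy⟩ := (hI.essential_succ i).exists_smul_mem
            (I.graded (i + 1)) ((I.homog_d i).proj_mem_range (I.graded i).isInternal _) hy hy0
          exact ⟨l, c, hc, hz ▸ I.d_d i z, hcy⟩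
      have hcp : c ∉ p := fun h => hcy (hpy c h)
      exact localizedModule_mk_eq_zero.2 ⟨⟨c, mem_homogCompl hc hcp⟩, by rw [← map_smul, hdc]⟩
  intro x hx
  have hgr := (I.graded i).localized p
  obtain ⟨s, hs, hps⟩ := locIdeal_eq_span (𝒜 := 𝒜) p hp
  obtain ⟨t, ht⟩ := exists_eq_sum_proj hgr.isInternal x
  rw [ht]
  refine (map_sum (LocalizedModule.map (homogCompl 𝒜 p) (I.d i)) _ _).trans
    (Finset.sum_eq_zero fun g _ => hhom g _ (proj_mem hgr.isInternal g x) ?_)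
  rw [hps] at hx ⊢
  exact proj_mem_torsionBySet hs hgr hx g

end LocalizedResolution


/-! ### Elements of *E(R/q) annihilated by a prime. -/

section Envelope

variable {G : Type*} [AddCommGroup G] [DecidableEq G]
variable {R : Type u} [CommRing R] {𝒜 : G → AddSubgroup R}
variable {q : Ideal R} {E : Type u} [AddCommGroup E] [Module R E] {ℰ : G → AddSubgroup E}
variable {e : (R ⧸ q) →ₗ[R] E}

namespace IsStarInjectiveEnvelope

theorem smul_map_one_eq_zero (he : IsStarInjectiveEnvelope 𝒜 (quotGrading 𝒜 q) ℰ e) {r : R} :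
    r • e 1 = 0 ↔ r ∈ q := by
  rw [← map_smul, map_eq_zero_iff e he.mono, Algebra.smul_def, mul_one]
  exact Ideal.Quotient.eq_zero_iff_mem

variable [GradedRing 𝒜]

theorem map_one_mem (he : IsStarInjectiveEnvelope 𝒜 (quotGrading 𝒜 q) ℰ e) : e 1 ∈ ℰ 0 :=
  he.homog.mem ⟨1, SetLike.GradedOne.one_mem, map_one (Ideal.Quotient.mk q)⟩

/-- A nonzero homogeneous element of `*E(R/q)` has a nonzero homogeneous multiple in `R/q`. -/
theorem exists_smul_eq (he : IsStarInjectiveEnvelope 𝒜 (quotGrading 𝒜 q) ℰ e) {g : G} {y : E}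
    (hy : y ∈ ℰ g) (hy0 : y ≠ 0) :
    ∃ k, ∃ c ∈ 𝒜 k, ∃ r ∈ 𝒜 (g + k), c • y = r • e 1 ∧ c • y ≠ 0 := by
  have htop := iSup_eq_top_of_isInternal (isGradedModule_self 𝒜).isInternal
  have hrange : ∀ x ∈ LinearMap.range e, ∃ r : R, x = r • e 1 := by
    rintro _ ⟨x, rfl⟩
    obtain ⟨r, rfl⟩ := Ideal.Quotient.mk_surjective x
    refine ⟨r, ?_⟩
    rw [← map_smul, Algebra.smul_def, mul_one]
    rfl
  obtain ⟨k, c, hc, hcy, hcy0⟩ := he.essential.exists_smul_mem he.graded (by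
    intro x hx k
    obtain ⟨r, rfl⟩ := hrange x hx
    obtain ⟨r', -, hr'⟩ := he.graded.exists_proj_smul_eq htop he.map_one_mem r k
    rw [hr', ← map_smul]
    exact ⟨_, rfl⟩) hy hy0
  obtain ⟨r, hr⟩ := hrange _ hcy
  obtain ⟨r', hr', hrr'⟩ := he.graded.exists_proj_smul_eq htop he.map_one_mem r (g + k)
  rw [← hr, proj_of_mem _ (he.graded.smul_mem hc hy)] at hrr'
  exact ⟨k, c, hc, r', by rwa [sub_zero] at hr', hrr', hcy0⟩

variable [IsNoetherianRing R]

/-- The annihilators of the `s ^ n • y` form an ascending chain, which stabilizes at some `n`. If `s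
^ n • y` were nonzero, a nonzero multiple of it by `c` would lie in R/q and be killed by `s`; then
`c` annihilates `s ^ (n + 1) • y`, hence already `s ^ n • y`, a contradiction. -/
theorem exists_pow_smul_eq_zero (he : IsStarInjectiveEnvelope 𝒜 (quotGrading 𝒜 q) ℰ e) {g k : G}
    {y : E} (hy : y ∈ ℰ g) {s : R} (hs : s ∈ 𝒜 k) (hsq : s ∈ q) : ∃ n : ℕ, s ^ n • y = 0 := by
  let F : ℕ →o Ideal R :=
    { toFun := fun n => LinearMap.ker (LinearMap.toSpanSingleton R E (s ^ n • y))
      monotone' := monotone_nat_of_le_succ fun n c hc => by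
        change c • s ^ n • y = 0 at hc
        change c • s ^ (n + 1) • y = 0
        rw [pow_succ', mul_smul, smul_comm, hc, smul_zero] }
  have hF : ∀ n c, c ∈ F n ↔ c • s ^ n • y = 0 := fun _ _ => Iff.rfl
  obtain ⟨n, hn⟩ := monotone_stabilizes_iff_noetherian.2 ‹IsNoetherianRing R› F
  refine ⟨n, by_contra fun hny => ?_⟩
  obtain ⟨l, c, hc, r, hr, hcr, hc0⟩ := he.exists_smul_eq
    (he.graded.smul_mem (SetLike.pow_mem_graded n hs) hy) hny
  refine hc0 ((hF n c).1 ?_)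
  rw [hn (n + 1) n.le_succ, hF, pow_succ', mul_smul, smul_comm, hcr, smul_smul,
    he.smul_map_one_eq_zero]
  exact q.mul_mem_right r hsq

/-- Up to a homogeneous factor outside `p`, a homogeneous element of `*E(R/q)` annihilated by `p`
lies in `R/q`, and vanishes if `q ≠ p`. -/
theorem exists_smul_eq_of_annihilated (he : IsStarInjectiveEnvelope 𝒜 (quotGrading 𝒜 q) ℰ e)
    (hq : q.IsPrime) (hqh : q.IsHomogeneous 𝒜) {p : Ideal R} [p.IsPrime] {g : G} {y : E}
    (hy : y ∈ ℰ g) (hpy : ∀ a ∈ p, a • y = 0) :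
    ∃ k, ∃ c ∈ 𝒜 k, c ∉ p ∧ ∃ r ∈ 𝒜 (g + k), c • y = r • e 1 ∧ (r = 0 ∨ q = p) := by
  have hp1 : (1 : R) ∉ p := fun h => Ideal.IsPrime.ne_top' ((Ideal.eq_top_iff_one p).2 h)
  by_cases hy0 : y = 0
  · exact ⟨0, 1, SetLike.GradedOne.one_mem, hp1, 0, zero_mem _, by simp [hy0], Or.inl rfl⟩
  obtain ⟨k, c, hc, r, hr, hcr, hc0⟩ := he.exists_smul_eq hy hy0
  have hcp : c ∉ p := fun h => hc0 (hpy c h)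
  by_cases hqp : q = p
  · exact ⟨k, c, hc, hcp, r, hr, hcr, Or.inr hqp⟩
  -- A nonzero element of R/q has annihilator `q`. Since `p` kills `r • e 1`, this forces `p ≤ q`;
  -- if `q ≠ p`, the graded ideal `q` has a homogeneous element outside `p`, and a power of it kills
  -- `y`.
  have hrq : r ∉ q := fun h => hc0 (hcr.trans (he.smul_map_one_eq_zero.2 h))
  have hpq : p ≤ q := by
    intro a ha
    have : (a * r) • e 1 = 0 := by
      rw [mul_smul, ← hcr, smul_comm, hpy a ha, smul_zero]
    exact (hq.mem_or_mem (he.smul_map_one_eq_zero.1 this)).resolve_right hrq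
  obtain ⟨s, l, hs, hsq, hsp⟩ : ∃ s l, s ∈ 𝒜 l ∧ s ∈ q ∧ s ∉ p := by
    classical
    by_contra! hcon
    refine hqp (le_antisymm (fun x hx => ?_) hpq)
    rw [← DirectSum.sum_support_decompose 𝒜 x]
    exact sum_mem fun l _ => hcon _ l (SetLike.coe_mem _) (hqh l hx)
  obtain ⟨n, hn⟩ := he.exists_pow_smul_eq_zero hy hs hsq
  exact ⟨n • l, s ^ n, SetLike.pow_mem_graded n hs,
    fun h => hsp (Ideal.IsPrime.mem_of_pow_mem ‹_› n h),
    0, zero_mem _, by rw [hn, zero_smul], Or.inl rfl⟩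

end IsStarInjectiveEnvelope

end Envelope

/-! ### The grading of a direct sum. -/

section DirectSums

variable {G : Type*} {Λ : Type*} {X : Λ → Type*} [∀ α, AddCommGroup (X α)]
variable {𝒳 : ∀ α, G → AddSubgroup (X α)}

theorem of_mem_directSumGrading [DecidableEq Λ] {g : G} {α : Λ} {x : X α} (hx : x ∈ 𝒳 α g) :
    DirectSum.of X α x ∈ directSumGrading 𝒳 g := by
  intro β
  by_cases hβ : β = α
  · subst hβ
    rwa [DirectSum.of_eq_same]
  · rw [DirectSum.of_eq_of_ne _ _ _ hβ]
    exact zero_mem _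

theorem isInternal_directSumGrading [DecidableEq G] (h : ∀ α, IsInternal (𝒳 α)) :
    IsInternal (directSumGrading 𝒳) := by
  classical
  refine isInternal_of_proj (fun g => DirectSum.map fun α => proj (h α) g) ?_ ?_ ?_
  · intro g x hx
    refine DFinsupp.ext fun α => ?_
    rw [DirectSum.map_apply]
    exact proj_of_mem _ (hx α)
  · intro g k hgk x hx
    refine DFinsupp.ext fun α => ?_
    rw [DirectSum.map_apply]
    exact proj_of_ne _ hgk (hx α)
  · rw [eq_top_iff]
    intro x _
    induction x using DirectSum.induction_on with
    | zero => exact zero_mem _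
    | add x y hx hy =>
      exact add_mem (hx (AddSubgroup.mem_top _)) (hy (AddSubgroup.mem_top _))
    | of α x =>
      refine homogeneous_induction (h α)
        (P := fun x => DirectSum.of X α x ∈ ⨆ g, directSumGrading 𝒳 g) ?_ ?_ ?_ x
      · rw [map_zero]
        exact zero_mem _
      · intro x y hx hy
        rw [map_add]
        exact add_mem hx hy
      · intro g x hx
        exact AddSubgroup.mem_iSup_of_mem g (of_mem_directSumGrading hx)

end DirectSums

/-! ### Degrees modulo a graded prime in a standard ring. -/

section Standard

variable {r : ℕ} {R : Type u} [CommRing R] {𝒜 : (Fin r → ℤ) → AddSubgroup R} [GradedRing 𝒜]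

/-- In a standard graded ring, the degree of a homogeneous element outside `p` vanishes in the
directions of `p`. -/
theorem dirHom_eq_zero (hstd : IsStandard 𝒜) {p : Ideal R} (hp : p.IsHomogeneous 𝒜)
    {n : Fin r → ℤ} {x : R} (hx : x ∈ 𝒜 n) (hxp : x ∉ p) : dirHom 𝒜 p n = 0 := by
  by_contra hn
  -- All of R/p has φ-degree 0: generators in the directions of `dir 𝒜 p` vanish modulo `p`, the
  -- other generators have φ-degree 0, and the elements of φ-degree 0 form a subring.
  have hle : (⊤ : Subring R) ≤
      (quotRegradedZero 𝒜 p (dirHom 𝒜 p)).comap (Ideal.Quotient.mk p) := by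
    rw [← (hstd : Subring.closure _ = ⊤), Subring.closure_le]
    have hmem : ∀ g, dirHom 𝒜 p g = 0 → ∀ y ∈ 𝒜 g,
        Ideal.Quotient.mk p y ∈ regrade (M := R ⧸ p) (dirHom 𝒜 p) (quotGrading 𝒜 p) 0 :=
      fun g hg y hy => AddSubgroup.mem_iSup_of_mem
        (S := fun g : {g // dirHom 𝒜 p g = 0} => quotGrading 𝒜 p g) ⟨g, hg⟩ ⟨y, hy, rfl⟩
    rintro y (hy | hy)
    · exact hmem 0 (map_zero _) y hy
    · obtain ⟨j, hj⟩ := Set.mem_iUnion.1 hy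
      by_cases hjp : (𝒜 (Pi.single j 1) : Set R) ⊆ p
      · rw [SetLike.mem_coe, Subring.mem_comap, Ideal.Quotient.eq_zero_iff_mem.2 (hjp hj)]
        exact zero_mem _
      · refine hmem _ (funext fun k => ?_) y hj
        have hk := (dir 𝒜 p).orderEmbOfFin_mem rfl k
        refine Pi.single_eq_of_ne (fun h => hjp ?_) _
        rw [h] at hk
        classical
        exact (Finset.mem_filter.1 hk).2
  have hx0 : Ideal.Quotient.mk p x ∈
      ⨆ g : {g // dirHom 𝒜 p g = 0}, quotGrading 𝒜 p g := hle (Subring.mem_top x)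
  -- Since `n` has nonzero φ-degree, every lift of an element of φ-degree 0 has its degree `n`
  -- component in the graded ideal `p`. Quantifying over all lifts lets the induction run on classes
  -- modulo `p`.
  have key : ∀ y, Ideal.Quotient.mk p y = Ideal.Quotient.mk p x →
      (DirectSum.decompose 𝒜 y n : R) ∈ p := by
    refine AddSubgroup.iSup_induction
      (C := fun z => ∀ y, Ideal.Quotient.mk p y = z → (DirectSum.decompose 𝒜 y n : R) ∈ p) _ hx0
      ?_ ?_ ?_
    · rintro ⟨g, hg⟩ _ ⟨y₀, hy₀, rfl⟩ y hy
      have hng : g ≠ n := by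
        rintro rfl
        exact hn hg
      have := hp n (Ideal.Quotient.eq.1 hy)
      rw [DirectSum.decompose_sub] at this
      change (DirectSum.decompose 𝒜 y n : R) - (DirectSum.decompose 𝒜 y₀ n : R) ∈ p at this
      rwa [DirectSum.decompose_of_mem_ne 𝒜 hy₀ hng, sub_zero] at this
    · exact fun y hy => hp n (Ideal.Quotient.eq_zero_iff_mem.1 hy)
    · intro z z' hz hz' y hy
      obtain ⟨w, rfl⟩ := Ideal.Quotient.mk_surjective z
      obtain ⟨w', rfl⟩ := Ideal.Quotient.mk_surjective z'
      have h1 := hp n (Ideal.Quotient.eq.1 (hy.trans (map_add (Ideal.Quotient.mk p) w w').symm))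
      rw [DirectSum.decompose_sub, DirectSum.decompose_add] at h1
      change (DirectSum.decompose 𝒜 y n : R) -
        ((DirectSum.decompose 𝒜 w n : R) + (DirectSum.decompose 𝒜 w' n : R)) ∈ p at h1
      have := add_mem h1 (add_mem (hz w rfl) (hz' w' rfl))
      rwa [sub_add_cancel] at this
  have := key x rfl
  rw [DirectSum.decompose_of_mem_same 𝒜 hx] at this
  exact hxp this

end Standard


theorem mk_mem_locIdeal {G : Type*} [AddCommGroup G] {R : Type u} [CommRing R]
    {𝒜 : G → AddSubgroup R} [SetLike.GradedMonoid 𝒜] {p : Ideal R} [p.IsPrime] {r : R} (hr : r ∈ p)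
    (s : homogCompl 𝒜 p) : Localization.mk r s ∈ locIdeal 𝒜 p := by
  rw [Localization.mk_eq_mk', IsLocalization.mk'_eq_mul_mk'_one]
  exact Ideal.mul_mem_right _ _ (Ideal.mem_map_of_mem _ hr)

/-- Numerator and denominator are both homogeneous outside `p`, so both degrees vanish under
`dirHom`. -/
theorem dirHom_eq_zero_of_mem_locGrading {r : ℕ} {R : Type u} [CommRing R]
    {𝒜 : (Fin r → ℤ) → AddSubgroup R} [GradedRing 𝒜] (hstd : IsStandard 𝒜) {p : Ideal R}
    [p.IsPrime] (hp : p.IsHomogeneous 𝒜) {g : Fin r → ℤ} {t : HomogLoc 𝒜 p}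
    (ht : t ∈ locGrading 𝒜 p g) (htp : t ∉ locIdeal 𝒜 p) : dirHom 𝒜 p g = 0 := by
  obtain ⟨k, b, s, hb, hs, rfl⟩ := ht
  have h1 := dirHom_eq_zero hstd hp hb fun h => htp (mk_mem_locIdeal h s)
  rwa [map_add, dirHom_eq_zero hstd hp hs s.2.2, add_zero] at h1

/-! ### A homogeneous basis of the P-torsion in the localized term. -/

section Basis

variable {G : Type*} [AddCommGroup G] [DecidableEq G]
variable {R : Type u} [CommRing R] {𝒜 : G → AddSubgroup R} [GradedRing 𝒜]
variable {D : Type u} [AddCommGroup D] [Module R D] {𝒟 : G → AddSubgroup D}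
variable {Λ : Type u} [DecidableEq Λ] {𝔭 : Λ → Ideal R} {n : Λ → G}
variable {E : Λ → Type u} [∀ α, AddCommGroup (E α)] [∀ α, Module R (E α)]
variable {ℰ : ∀ α, G → AddSubgroup (E α)} {e : ∀ α, (R ⧸ 𝔭 α) →ₗ[R] E α}
variable (θ : D ≃ₗ[R] DirectSum Λ E)

/-- The element of `D ≅ ⨁ *E(R/𝔭_α)(-n_α)` corresponding to `1 ∈ R/𝔭_α`. -/
def generator (e : ∀ α, (R ⧸ 𝔭 α) →ₗ[R] E α) (α : Λ) : D :=
  θ.symm (DirectSum.lof R Λ E α (e α 1))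

variable {θ}

/-- Only `θ`, not its inverse, is assumed to preserve degrees. The generator and its component of
degree `n α` have the same image under `θ`, so they agree. -/
theorem generator_mem (hD : IsGradedModule 𝒜 𝒟)
    (he : ∀ α, IsStarInjectiveEnvelope 𝒜 (quotGrading 𝒜 (𝔭 α)) (ℰ α) (e α))
    (hθ : IsHomog 𝒟 (directSumGrading fun α => shift (ℰ α) (-n α)) θ.toLinearMap) (α : Λ) :
    generator θ e α ∈ 𝒟 (n α) := by
  have hint := isInternal_directSumGrading fun α => ((he α).graded.shift (-n α)).isInternal
  have h1 : θ (generator θ e α) ∈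
      directSumGrading (fun α => shift (ℰ α) (-n α)) (n α) := by
    rw [generator, LinearEquiv.apply_symm_apply]
    refine of_mem_directSumGrading (𝒳 := fun α => shift (ℰ α) (-n α)) ?_
    change e α 1 ∈ ℰ α (n α + -n α)
    rw [add_neg_cancel]
    exact (he α).map_one_mem
  have h2 := hθ.proj_map hD.isInternal hint (n α) (generator θ e α)
  have h3 : θ (proj hD.isInternal (n α) (generator θ e α)) = θ (generator θ e α) :=
    h2.symm.trans (proj_of_mem hint h1)
  rw [← θ.injective h3]
  exact proj_mem _ _ _

variable {p : Ideal R} [p.IsPrime]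

theorem mk_generator_mem_torsionBySet {α : Λ} (hα : 𝔭 α = p) :
    (LocalizedModule.mk (generator θ e α) 1 : HomogLocModule 𝒜 p D) ∈
      Submodule.torsionBySet (HomogLoc 𝒜 p) (HomogLocModule 𝒜 p D)
        (locIdeal 𝒜 p : Set (HomogLoc 𝒜 p)) := by
  rw [Submodule.mem_torsionBySet_iff]
  rintro ⟨a, ha⟩
  have hle : locIdeal 𝒜 p ≤ LinearMap.ker (LinearMap.toSpanSingleton (HomogLoc 𝒜 p)
      (HomogLocModule 𝒜 p D) (LocalizedModule.mk (generator θ e α) 1)) := by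
    rw [locIdeal, Ideal.map_le_iff_le_comap]
    intro b hb
    change algebraMap R (HomogLoc 𝒜 p) b •
      (LocalizedModule.mk (generator θ e α) 1 : HomogLocModule 𝒜 p D) = 0
    have hb1 : b • (1 : R ⧸ 𝔭 α) = 0 := by
      rw [Algebra.smul_def, mul_one]
      exact Ideal.Quotient.eq_zero_iff_mem.2 (hα ▸ hb)
    rw [algebraMap_smul, LocalizedModule.smul'_mk, generator, ← map_smul, ← map_smul, ← map_smul,
      hb1, map_zero, map_zero, map_zero, LocalizedModule.zero_mk]
  exact hle ha

/-- The elements `1 ∈ R/p` of the summands `*E(R/p)` are independent modulo `p` in the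
localization. -/
theorem mem_locIdeal_of_sum_smul_generator_eq_zero
    (he : ∀ α, IsStarInjectiveEnvelope 𝒜 (quotGrading 𝒜 (𝔭 α)) (ℰ α) (e α))
    {ι : Type*} {j : ι → Λ} (hj : Function.Injective j) (hjp : ∀ x, 𝔭 (j x) = p)
    (s : Finset ι) (t : ι → HomogLoc 𝒜 p)
    (hsum : ∑ x ∈ s, t x • (LocalizedModule.mk (generator θ e (j x)) 1 : HomogLocModule 𝒜 p D) = 0)
    {x : ι} (hx : x ∈ s) : t x ∈ locIdeal 𝒜 p := by
  classical
  -- Projecting the relation to the summand of index `j x` leaves `t x` times the image of 1. As R/p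
  -- is torsion-free over the homogeneous elements outside `p`, the numerator of `t x` lies in `p`.
  let c : D →ₗ[R] E (j x) := DirectSum.component R Λ E (j x) ∘ₗ θ.toLinearMap
  have hc : ∀ y, c (generator θ e (j y)) = if y = x then e (j x) 1 else 0 := by
    intro y
    change DirectSum.component R Λ E (j x) (θ (θ.symm _)) = _
    rw [LinearEquiv.apply_symm_apply]
    split_ifs with hyx
    · subst hyx
      exact DirectSum.component.lof_self _ _ _
    · exact DirectSum.of_eq_of_ne _ _ _ fun h => hyx (hj h.symm)
  have h1 := congrArg (LocalizedModule.map (homogCompl 𝒜 p) c) hsum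
  rw [map_zero, map_sum, Finset.sum_eq_single x] at h1
  · rw [map_smul, localizedModule_map_mk, hc, if_pos rfl] at h1
    induction htx : t x using Localization.induction_on with
    | H y =>
      obtain ⟨r, u⟩ := y
      rw [htx, LocalizedModule.mk_smul_mk] at h1
      obtain ⟨v, hv⟩ := localizedModule_mk_eq_zero.1 h1
      rw [smul_smul, (he _).smul_map_one_eq_zero, hjp] at hv
      exact mk_mem_locIdeal ((Ideal.IsPrime.mem_or_mem ‹_› hv).resolve_left v.2.2) u
  · intro y _ hyx
    rw [map_smul, localizedModule_map_mk, hc, if_neg hyx, LocalizedModule.zero_mk, smul_zero]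
  · exact fun h => absurd hx h

/-- The homogeneous elements annihilated by `p` in the localization are homogeneous combinations
of the elements `1 ∈ R/p` of the summands `*E(R/p)`. -/
theorem exists_eq_sum_smul_generator [IsNoetherianRing R] [SetLike.GradedSMul 𝒜 𝒟]
    (h𝔭_prime : ∀ α, (𝔭 α).IsPrime) (h𝔭_graded : ∀ α, (𝔭 α).IsHomogeneous 𝒜)
    (he : ∀ α, IsStarInjectiveEnvelope 𝒜 (quotGrading 𝒜 (𝔭 α)) (ℰ α) (e α))
    (hθ : IsHomog 𝒟 (directSumGrading fun α => shift (ℰ α) (-n α)) θ.toLinearMap)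
    {g : G} {x : HomogLocModule 𝒜 p D} (hx : x ∈ locModuleGrading 𝒜 p 𝒟 g)
    (hpx : x ∈ Submodule.torsionBySet (HomogLoc 𝒜 p) (HomogLocModule 𝒜 p D)
      (locIdeal 𝒜 p : Set (HomogLoc 𝒜 p))) :
    ∃ (F : Finset {α // 𝔭 α = p}) (t : {α // 𝔭 α = p} → HomogLoc 𝒜 p),
      (∀ α : {α // 𝔭 α = p}, t α ∈ locGrading 𝒜 p (g - n α)) ∧
      x = ∑ α ∈ F, t α • LocalizedModule.mk (generator θ e α) 1 := by
  classical
  obtain ⟨k, y, s, hy, hs, rfl, hpy⟩ := exists_mk_of_mem_torsionBySet hx hpx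
  have hcoord : ∀ α, ∃ l, ∃ c ∈ 𝒜 l, c ∉ p ∧ ∃ r ∈ 𝒜 (g + k + -n α + l),
      c • θ y α = r • e α 1 ∧ (r = 0 ∨ 𝔭 α = p) := by
    intro α
    refine (he α).exists_smul_eq_of_annihilated (h𝔭_prime α) (h𝔭_graded α)
      (hθ.mem hy α) fun a ha => ?_
    change a • DirectSum.component R Λ E α (θ y) = 0
    rw [← map_smul, ← map_smul, hpy a ha, map_zero, map_zero]
  choose l c hc hcp r hr hcr hr0 using hcoord
  let u (α : Λ) : homogCompl 𝒜 p := ⟨c α, mem_homogCompl (hc α) (hcp α)⟩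
  -- From `c α • θ y α = r α • e α 1` the coordinate of `y / s` at `α` is `r α / (c α * s)` times
  -- the generator.
  let t (α : Λ) : HomogLoc 𝒜 p := Localization.mk (r α) (u α * s)
  have ht : ∀ α, t α ∈ locGrading 𝒜 p (g - n α) := fun α =>
    ⟨l α + k, r α, u α * s, by
      rw [show g - n α + (l α + k) = g + k + -n α + l α by abel]
      exact hr α, SetLike.GradedMul.mul_mem (hc α) hs, rfl⟩
  have hterm : ∀ α, LocalizedModule.mk (θ.symm (DirectSum.lof R Λ E α (θ y α))) s =
      t α • (LocalizedModule.mk (generator θ e α) 1 : HomogLocModule 𝒜 p D) := by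
    intro α
    rw [LocalizedModule.mk_smul_mk, mul_one, generator, ← map_smul, ← map_smul, ← hcr, map_smul,
      map_smul]
    exact (LocalizedModule.mk_cancel_common_left (u α) s _).symm
  have hzero : ∀ α, 𝔭 α ≠ p →
      t α • (LocalizedModule.mk (generator θ e α) 1 : HomogLocModule 𝒜 p D) = 0 := by
    intro α hα
    have : t α = 0 := by
      change Localization.mk (r α) _ = 0
      rw [(hr0 α).resolve_right hα, Localization.mk_zero]
    rw [this, zero_smul]
  refine ⟨(DFinsupp.support (θ y)).subtype fun α => 𝔭 α = p, fun α => t α, fun α => ht α, ?_⟩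
  rw [Finset.sum_subtype_eq_sum_filter (f := fun α =>
      t α • (LocalizedModule.mk (generator θ e α) 1 : HomogLocModule 𝒜 p D)),
    Finset.sum_filter_of_ne fun α _ h => not_not.1 fun hα => h (hzero α hα)]
  have hysum : y = ∑ α ∈ DFinsupp.support (θ y), θ.symm (DirectSum.lof R Λ E α (θ y α)) := by
    rw [← map_sum, LinearEquiv.eq_symm_apply]
    exact (DirectSum.sum_support_of (θ y)).symm
  let mkHom : D →+ HomogLocModule 𝒜 p D :=
    { toFun := fun y => LocalizedModule.mk y s
      map_zero' := LocalizedModule.zero_mk s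
      map_add' := fun a b => by
        rw [LocalizedModule.mk_add_mk, ← smul_add, LocalizedModule.mk_cancel_common_left] }
  calc LocalizedModule.mk y s = mkHom (∑ α ∈ DFinsupp.support (θ y),
        θ.symm (DirectSum.lof R Λ E α (θ y α))) := congrArg mkHom hysum
    _ = _ := by
      rw [map_sum]
      exact Finset.sum_congr rfl fun α _ => hterm α

end Basis

/-! ### Freeness and rank of the components of *Ext, and the theorem. -/

theorem mk_smul_starExt {G : Type*} [AddCommGroup G] [DecidableEq G] {R : Type u} [CommRing R]
    {𝒜 : G → AddSubgroup R} {N : Type u} [AddCommGroup N] [Module R N] {𝒩 : G → AddSubgroup N}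
    (J : StarInjectiveResolution 𝒜 𝒩) (I : Ideal R) (i : ℕ) (t : R)
    (x : StarExt (quotGrading 𝒜 I) J i) : Ideal.Quotient.mk I t • x = t • x := rfl

theorem locIdeal_ne_top {G : Type*} [AddCommGroup G] {R : Type u} [CommRing R]
    (𝒜 : G → AddSubgroup R) [SetLike.GradedMonoid 𝒜] (p : Ideal R) [hp : p.IsPrime] :
    locIdeal 𝒜 p ≠ ⊤ := by
  have hd : Disjoint (homogCompl 𝒜 p : Set R) p :=
    Set.disjoint_left.2 fun s hs => hs.2
  exact (IsLocalization.isPrime_of_isPrime_disjoint (homogCompl 𝒜 p) (HomogLoc 𝒜 p) p hp hd).ne_top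

/-- A criterion for a family of homogeneous classes to be a basis of a component of `*Ext^i`. -/
theorem free_and_mk_eq_rank_regradedComponent {G : Type*} [AddCommGroup G] [DecidableEq G]
    {R : Type u} [CommRing R] {𝒜 : G → AddSubgroup R} [SetLike.GradedMonoid 𝒜]
    {N : Type u} [AddCommGroup N] [Module R N] {𝒩 : G → AddSubgroup N}
    (J : StarInjectiveResolution 𝒜 𝒩) {I : Ideal R} (hI : I ≠ ⊤) {H : Type*} [AddCommGroup H]
    (φ : G →+ H) (i : ℕ) (a : H) {ι : Type u} {v : ι → StarExt (quotGrading 𝒜 I) J i}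
    (hv : ∀ x, ∃ g, φ g = a ∧ v x ∈ StarExt.grading (quotGrading 𝒜 I) J i g)
    (hli : ∀ (s : Finset ι) (t : ι → R), ∑ x ∈ s, t x • v x = 0 → ∀ x ∈ s, t x ∈ I)
    (hspan : ∀ g, φ g = a → ∀ y ∈ StarExt.grading (quotGrading 𝒜 I) J i g,
      y ∈ AddSubgroup.closure {z | ∃ k, φ k = 0 ∧ ∃ t ∈ 𝒜 k, ∃ x, z = t • v x}) :
    Module.Free (quotRegradedZero 𝒜 I φ) (StarExt.regradedComponent J I φ i a) ∧
      Cardinal.mk ι =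
        Module.rank (quotRegradedZero 𝒜 I φ) (StarExt.regradedComponent J I φ i a) := by
  let b (x : ι) : StarExt.regradedComponent J I φ i a :=
    ⟨v x, by
      obtain ⟨g, hg, hx⟩ := hv x
      exact AddSubgroup.mem_iSup_of_mem
        (S := fun g : {g // φ g = a} => StarExt.grading (quotGrading 𝒜 I) J i g) ⟨g, hg⟩ hx⟩
  have hb : LinearIndependent (quotRegradedZero 𝒜 I φ) b := by
    rw [linearIndependent_iff']
    -- Coefficients in `quotRegradedZero` are lifted to `R`, where the independence hypothesis is
    -- stated.
    intro s c hc x hx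
    choose t ht using fun x => Ideal.Quotient.mk_surjective (c x).1
    have h1 : ∑ y ∈ s, t y • v y = 0 := by
      have := congrArg Subtype.val hc
      rw [AddSubmonoidClass.coe_finsetSum] at this
      refine Eq.trans (Finset.sum_congr rfl fun y _ => ?_) this
      rw [← mk_smul_starExt, ht]
      rfl
    refine Subtype.ext ?_
    rw [← ht]
    exact Ideal.Quotient.eq_zero_iff_mem.2 (hli s t h1 x hx)
  have hb' : ⊤ ≤ Submodule.span (quotRegradedZero 𝒜 I φ) (Set.range b) := by
    have hle : regrade φ (StarExt.grading (quotGrading 𝒜 I) J i) a ≤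
        ((Submodule.span (quotRegradedZero 𝒜 I φ) (Set.range b)).map
          (Submodule.subtype _)).toAddSubgroup := by
      refine iSup_le ?_
      rintro ⟨g, hg⟩ y hy
      refine (AddSubgroup.closure_le _).2 ?_ (hspan g hg y hy)
      rintro _ ⟨k, hk, t, ht, x, rfl⟩
      let t' : quotRegradedZero 𝒜 I φ := ⟨Ideal.Quotient.mk I t, AddSubgroup.mem_iSup_of_mem
        (S := fun g : {g // φ g = 0} => quotGrading 𝒜 I g) ⟨k, hk⟩ ⟨t, ht, rfl⟩⟩
      exact ⟨t' • b x, Submodule.smul_mem _ _ (Submodule.subset_span ⟨x, rfl⟩), rfl⟩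
    rintro ⟨x, hx⟩ -
    obtain ⟨y, hy, hyx⟩ := hle hx
    rwa [← show y = ⟨x, hx⟩ from Subtype.ext hyx]
  -- The coefficient ring is then commutative and nontrivial, so any basis, finite or infinite, has
  -- cardinality equal to the rank.
  have : Nontrivial (R ⧸ I) := Ideal.Quotient.nontrivial_iff.2 hI
  let B := Module.Basis.mk hb hb'
  exact ⟨Module.Free.of_basis B, B.mk_eq_rank''⟩

end MultiGraded

end

theorem theorem2p6 {r : ℕ} {R : Type u} [CommRing R] [IsNoetherianRing R]
    (𝒜 : (Fin r → ℤ) → AddSubgroup R) [GradedRing 𝒜]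
    (hpos : MultiGraded.IsPositivelyGraded 𝒜) (hstd : MultiGraded.IsStandard 𝒜)
    {M : Type u} [AddCommGroup M] [Module R M]
    (ℳ : (Fin r → ℤ) → AddSubgroup M) [DirectSum.Decomposition ℳ] [SetLike.GradedSMul 𝒜 ℳ]
    -- the minimal *injective resolution of `M`
    (I : MultiGraded.StarInjectiveResolution 𝒜 ℳ) (hI : I.IsMinimal)
    (i : ℕ)
    -- the decomposition of its `i`-th term as the direct sum of the `*E(R/𝔭_α)(-n_α)`
    {Λ : Type u} (𝔭 : Λ → Ideal R) (n : Λ → Fin r → ℤ)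
    (h𝔭_prime : ∀ α, (𝔭 α).IsPrime) (h𝔭_graded : ∀ α, (𝔭 α).IsHomogeneous 𝒜)
    (E : Λ → Type u) [∀ α, AddCommGroup (E α)] [∀ α, Module R (E α)]
    (ℰ : ∀ α, (Fin r → ℤ) → AddSubgroup (E α))
    (e : ∀ α, (R ⧸ 𝔭 α) →ₗ[R] E α)
    (he : ∀ α, MultiGraded.IsStarInjectiveEnvelope 𝒜 (MultiGraded.quotGrading 𝒜 (𝔭 α)) (ℰ α) (e α))
    (θ : I.obj i ≃ₗ[R] DirectSum Λ E)
    (hθ : MultiGraded.IsHomog (I.grading i)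
      (MultiGraded.directSumGrading fun α => MultiGraded.shift (ℰ α) (-n α)) θ.toLinearMap)
    -- a graded prime containing `R_1`
    (p : Ideal R) [p.IsPrime] (hp_graded : p.IsHomogeneous 𝒜)
    (hp : Ideal.span (𝒜 1 : Set R) ≤ p)
    (a : Fin (MultiGraded.dir 𝒜 p).card → ℤ) :
    -- `M_(p)` has a *injective resolution over `R_(p)`, and each one of them can be used to form
    -- the module `*Ext^i`
    Nonempty (MultiGraded.StarInjectiveResolution (MultiGraded.locGrading 𝒜 p)
      (MultiGraded.locModuleGrading 𝒜 p ℳ)) ∧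
    ∀ J : MultiGraded.StarInjectiveResolution (MultiGraded.locGrading 𝒜 p)
        (MultiGraded.locModuleGrading 𝒜 p ℳ),
      Module.Free
        (MultiGraded.quotRegradedZero (MultiGraded.locGrading 𝒜 p) (MultiGraded.locIdeal 𝒜 p)
          (MultiGraded.dirHom 𝒜 p))
        (MultiGraded.StarExt.regradedComponent J (MultiGraded.locIdeal 𝒜 p)
          (MultiGraded.dirHom 𝒜 p) i a) ∧
      Cardinal.mk {α : Λ // 𝔭 α = p ∧ MultiGraded.dirHom 𝒜 p (n α) = a} =
        Module.rank
          (MultiGraded.quotRegradedZero (MultiGraded.locGrading 𝒜 p) (MultiGraded.locIdeal 𝒜 p)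
            (MultiGraded.dirHom 𝒜 p))
          (MultiGraded.StarExt.regradedComponent J (MultiGraded.locIdeal 𝒜 p)
            (MultiGraded.dirHom 𝒜 p) i a) := by
  classical
  refine ⟨⟨I.localized p⟩, fun J => ?_⟩
  have hM := MultiGraded.isGradedModule_of_decomposition 𝒜 ℳ
  obtain ⟨S, hS, hpS⟩ := MultiGraded.locIdeal_eq_span (𝒜 := 𝒜) p hp_graded
  obtain ⟨Ψ, hΨ⟩ := MultiGraded.exists_starExt_equiv (MultiGraded.locIdeal 𝒜 p) hS hpS
    (hM.localized p) J (I.localized p) (hI.localized_d_eq_zero p hM hp_graded) i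
  -- The prospective basis consists of the images in the localization of the elements 1 ∈ R/p of the
  -- summands with 𝔭_α = p, transported to *Ext by the inverse of `Ψ`.
  let w (α : {α // 𝔭 α = p}) : Submodule.torsionBySet (MultiGraded.HomogLoc 𝒜 p)
      ((I.localized p).obj i) (MultiGraded.locIdeal 𝒜 p : Set (MultiGraded.HomogLoc 𝒜 p)) :=
    ⟨LocalizedModule.mk (MultiGraded.generator θ e α) 1,
      MultiGraded.mk_generator_mem_torsionBySet α.2⟩
  have hw : ∀ α : {α // 𝔭 α = p}, Ψ.symm (w α) ∈ MultiGraded.StarExt.grading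
      (MultiGraded.quotGrading (MultiGraded.locGrading 𝒜 p) (MultiGraded.locIdeal 𝒜 p)) J i
      (n α) := by
    intro α
    rw [hΨ, LinearEquiv.apply_symm_apply]
    exact MultiGraded.mk_one_mem_locModuleGrading
      (MultiGraded.generator_mem (I.graded i) he hθ α)
  refine MultiGraded.free_and_mk_eq_rank_regradedComponent J (MultiGraded.locIdeal_ne_top 𝒜 p)
    (MultiGraded.dirHom 𝒜 p) i a
    (v := fun α : {α : Λ // 𝔭 α = p ∧ MultiGraded.dirHom 𝒜 p (n α) = a} =>
      Ψ.symm (w ⟨α, α.2.1⟩))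
    (fun α => ⟨n α, α.2.2, hw ⟨α, α.2.1⟩⟩) ?_ ?_
  · intro s t hst α hα
    have h2 : ∑ β ∈ s, t β • w ⟨β, β.2.1⟩ = 0 := by
      rw [← map_zero Ψ, ← hst, map_sum]
      exact Finset.sum_congr rfl fun β _ => by rw [map_smul, LinearEquiv.apply_symm_apply]
    have h3 := congrArg Subtype.val h2
    rw [AddSubmonoidClass.coe_finsetSum] at h3
    exact MultiGraded.mem_locIdeal_of_sum_smul_generator_eq_zero he
      (j := fun α : {α : Λ // 𝔭 α = p ∧ MultiGraded.dirHom 𝒜 p (n α) = a} => (α : Λ))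
      Subtype.val_injective (fun α => α.2.1) s t h3 hα
  · intro g hg x hx
    obtain ⟨F, t, ht, hsum⟩ := MultiGraded.exists_eq_sum_smul_generator h𝔭_prime h𝔭_graded he hθ
      ((hΨ g x).1 hx) (Ψ x).2
    have hxF : x = ∑ α ∈ F, t α • Ψ.symm (w α) := by
      have h1 : Ψ x = ∑ α ∈ F, t α • w α := by
        refine Subtype.ext ?_
        rw [AddSubmonoidClass.coe_finsetSum]
        exact hsum
      rw [← Ψ.symm_apply_apply x, h1, map_sum]
      exact Finset.sum_congr rfl fun α _ => map_smul _ _ _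
    rw [hxF]
    refine sum_mem fun α _ => ?_
    -- A coefficient in P annihilates *Ext. Any other has φ-degree 0, and as its degree is `g - n α`
    -- this forces φ(n_α) = φ(g) = a, so the generator belongs to the chosen family.
    by_cases htα : t α ∈ MultiGraded.locIdeal 𝒜 p
    · have htor := MultiGraded.StarExt.isTorsionBySet J (MultiGraded.locIdeal 𝒜 p) i
      have h0 : t α • Ψ.symm (w α) = 0 := @htor _ ⟨t α, htα⟩
      rw [h0]
      exact zero_mem _
    · have hdeg := MultiGraded.dirHom_eq_zero_of_mem_locGrading hstd hp_graded (ht α) htα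
      have hα : MultiGraded.dirHom 𝒜 p (n α) = a := by
        rw [← hg, ← sub_eq_zero, ← neg_sub, ← map_sub, hdeg, neg_zero]
      exact AddSubgroup.subset_closure ⟨_, hdeg, t α, ht α, ⟨α, α.2, hα⟩, rfl⟩
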